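/- **Setting.** Let $(\Omega,\mathcal F,P)$ be a complete and separable probability space with expectation $\langle\cdot\rangle$, and let $\tau=\{\tau_x\}_{x\in\mathbb R^d}$ be a group of measurable maps $\tau_x:\Omega\to\Omega$ with $\tau_0=\mathrm{Id}$, $\tau_{x+y}=\tau_x\circ\tau_y$, $P(\tau_{-x}A)=P(A)$ for all $A\in\mathcal F$, and such that $(\omega,x)\mapsto\tau_x\omega$ is measurable with respect to the ($P\otimes dx$-completed) product $\sigma$-algebra. Assume that $\langle\cdot\rangle$ is ergodic: every $A\in\mathcal F$ with $\tau_xA=A$ for all $x$ has $P(A)\in\{0,1\}$. For $p\in(1,\infty)$ let $L^p_{\mathrm{pot}}(\Omega)$ be the closure in $L^p(\Omega)^d$ of the set of stochastic gradients $D\varphi=(D_1\varphi,\dots,D_d\varphi)$, where $D_i\varphi=\lim_{h\to0}\frac{\varphi\circ\tau_{he_i}-\varphi}{h}$ in $L^p(\Omega)$ and $\varphi$ ranges over all $\varphi\in L^p(\Omega)$ for which these limits exist for $i=1,\dots,d$. Let $Q\subset\mathbb R^d$ be open and bounded and let $V:\Omega\times Q\times\mathbb R^d\to\mathbb R$ satisfy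 * (A1) $V(\cdot,\cdot,F)$ is $\mathcal F\otimes\mathcal L(Q)$-measurable for all $F\in\mathbb R^d$, where $\mathcal L(Q)$ is the Lebesgue $\sigma$-algebra of $Q$; * (A2) $V(\omega,x,\cdot)$ is convex for a.a. $(\omega,x)\in\Omega\times Q$; * (A3') there are $C>0$ and $\lambda\in L^1(\Omega)$ ($\lambda>0$ almost surely) with $\langle\lambda^{-\frac1{p-1}}\rangle^{p-1}<C$ and $$\lambda(\omega)|F|^p-C\le V(\omega,x,F)\le C(\lambda(\omega)|F|^p+1)\quad\text{for a.a. }(\omega,x)\in\Omega\times Q\text{ and all }F\in\mathbb R^d .$$ For $\delta>0$, $x\in Q$, $F\in\mathbb R^d$ put $$V_{\hom}(x,F)=\inf_{\chi\in L^p_{\mathrm{pot}}(\Omega)}\langle V(\omega,x,F+\chi(\omega))\rangle,\qquad V_{\hom,\delta}(x,F)=\inf_{\chi\in L^p_{\mathrm{pot}}(\Omega)}\langle V(\omega,x,F+\chi(\omega))+\delta|\chi(\omega)|^p\rangle ,$$ where for every function $f$ the expectation is the extended integral $\langle f\rangle=\int f^+dP-\int f^-dP\in[-\infty,\infty]$ (with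 $\infty-\infty:=-\infty$, and $\int g\,dP$ denoting the supremum of the integrals of simple functions below $g\ge0$ if $g$ is not measurable; these two conventions matter only for $x$ in a null set). Define $\mathcal E_{\hom},\mathcal E_{\hom,\delta}:L^1(Q)\to\mathbb R\cup\{\infty\}$ by $$\mathcal E_{\hom}(u)=\int_QV_{\hom}(x,\nabla u(x))\,dx,\qquad \mathcal E_{\hom,\delta}(u)=\int_QV_{\hom,\delta}(x,\nabla u(x))\,dx\qquad\text{for }u\in W^{1,p}_0(Q),$$ and $\mathcal E_{\hom}(u)=\mathcal E_{\hom,\delta}(u)=\infty$ otherwise, where $W^{1,p}_0(Q)$ is the closure of $C_c^\infty(Q)$ in $W^{1,p}(Q)$. **Lemma.** These objects are well defined: for a.e. $x\in Q$, all $F\in\mathbb R^d$ and all $\delta>0$ the values $V_{\hom}(x,F)$ and $V_{\hom,\delta}(x,F)$ are finite, and $\mathcal E_{\hom}$, $\mathcal E_{\hom,\delta}$ never take the value $-\infty$. For all $x\in Q$ and $F\in\mathbb R^d$, $$\lim_{\delta\to0}V_{\hom,\delta}(x,F)=V_{\hom}(x,F).$$ Moreover, $\mathcal E_{\hom,\delta}$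 Mosco-converges to $\mathcal E_{\hom}$ in $L^1(Q)$ as $\delta\to0$ ($\delta>0$), that is: 1. if $u_\delta\rightharpoonup u$ weakly in $L^1(Q)$, then $\liminf_{\delta\to0}\mathcal E_{\hom,\delta}(u_\delta)\ge\mathcal E_{\hom}(u)$; 2. for every $u\in L^1(Q)$ there are $u_\delta\in L^1(Q)$ with $u_\delta\to u$ strongly in $L^1(Q)$ and $\mathcal E_{\hom,\delta}(u_\delta)\to\mathcal E_{\hom}(u)$. -/

import Mathlib

open MeasureTheory Filter Topology Set
open scoped ENNReal

noncomputable section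

namespace StochHom

/-- `ℝ^d` with its Euclidean norm and Lebesgue measure. -/
abbrev E (d : ℕ) : Type := EuclideanSpace ℝ (Fin d)

/-- The extended integral `∫ f⁺ dμ - ∫ f⁻ dμ ∈ [-∞, ∞]` of an extended-real function. It is the
usual integral whenever `f` is a.e. measurable and one of the two parts is finite
(with Lean's convention `∞ - ∞ = -∞` otherwise). -/
def extIntegral {α : Type*} [MeasurableSpace α] (μ : Measure α) (f : α → EReal) : EReal :=
  ((∫⁻ a, (f a).toENNReal ∂μ : ℝ≥0∞) : EReal) - ((∫⁻ a, (-(f a)).toENNReal ∂μ : ℝ≥0∞) : EReal)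

/-! ### The probabilistic setting -/

/-- A measurable, measure preserving action `τ = (τ_x)` of `ℝ^d` on the probability space.
Joint measurability is asked for the completed product `σ`-algebra. -/
structure IsDynamicalSystem {Ω : Type*} [MeasurableSpace Ω] (P : Measure Ω) {d : ℕ}
    (τ : E d → Ω → Ω) : Prop where
  zero : τ 0 = id
  add : ∀ x y : E d, τ (x + y) = τ x ∘ τ y
  measurable : ∀ x : E d, Measurable (τ x)
  measure_image : ∀ (x : E d) (A : Set Ω), MeasurableSet A → P (τ (-x) '' A) = P A
  jointly_measurable : NullMeasurable (fun z : Ω × E d => τ z.2 z.1) (P.prod volume)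

/-- Ergodicity: shift invariant events have probability `0` or `1`. -/
def IsErgodicSystem {Ω : Type*} [MeasurableSpace Ω] (P : Measure Ω) {d : ℕ}
    (τ : E d → Ω → Ω) : Prop :=
  ∀ A : Set Ω, MeasurableSet A → (∀ x : E d, τ x '' A = A) → P A = 0 ∨ P A = 1

/-- `φ ∈ W^{1,p}(Ω)` with stochastic gradient `Dφ = Ψ`: `φ` and `Ψ` are in `L^p`, and for every
coordinate direction `e_i` the quotients `(φ ∘ τ_{h e_i} - φ) / h` converge to `Ψ_i` in `L^p(Ω)` as
`h → 0`. -/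
def HasStochGrad {Ω : Type*} [MeasurableSpace Ω] (P : Measure Ω) {d : ℕ} (τ : E d → Ω → Ω)
    (p : ℝ) (φ : Ω → ℝ) (Ψ : Ω → E d) : Prop :=
  MemLp φ (ENNReal.ofReal p) P ∧ MemLp Ψ (ENNReal.ofReal p) P ∧
    ∀ i : Fin d, Tendsto
      (fun h : ℝ => eLpNorm
        (fun ω => h⁻¹ * (φ (τ (EuclideanSpace.single i h) ω) - φ ω) - Ψ ω i)
        (ENNReal.ofReal p) P)
      (𝓝[≠] 0) (𝓝 0)

/-- `L^p_pot(Ω)`, the closure in `L^p(Ω)^d` of the range of the stochastic gradient (as a set of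
functions, i.e. of all representatives of its elements). -/
def Lpot {Ω : Type*} [MeasurableSpace Ω] (P : Measure Ω) {d : ℕ} (τ : E d → Ω → Ω)
    (p : ℝ) : Set (Ω → E d) :=
  {χ | MemLp χ (ENNReal.ofReal p) P ∧ ∀ ε : ℝ≥0∞, 0 < ε →
    ∃ (φ : Ω → ℝ) (Ψ : Ω → E d), HasStochGrad P τ p φ Ψ ∧
      eLpNorm (fun ω => χ ω - Ψ ω) (ENNReal.ofReal p) P < ε}

/-! ### Assumptions on the integrand

The integrand is a total function; its values for `x ∉ Q` play no role. -/

/-- The Lebesgue `σ`-algebra `𝓛(Q)` on the subset `Q` of `ℝ^d`. -/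
abbrev lebesgueSigma {d : ℕ} (Q : Set (E d)) : MeasurableSpace Q :=
  (eventuallyMeasurableSpace (inferInstance : MeasurableSpace (E d)) (ae volume)).comap
    Subtype.val

/-- `V(·,·,F)` is `𝓕 ⊗ 𝓛(Q)`-measurable for all `F`. -/
def IntegrandMeasurable {Ω : Type*} [mΩ : MeasurableSpace Ω] {d : ℕ} (Q : Set (E d))
    (V : Ω → E d → E d → ℝ) : Prop :=
  ∀ F : E d, @Measurable (Ω × Q) ℝ (@Prod.instMeasurableSpace Ω Q mΩ (lebesgueSigma Q)) _
    (fun z => V z.1 z.2 F)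

/-- `V(ω,x,·)` is convex for a.a. `(ω,x) ∈ Ω × Q`. -/
def IntegrandConvex {Ω : Type*} [MeasurableSpace Ω] (P : Measure Ω) {d : ℕ} (Q : Set (E d))
    (V : Ω → E d → E d → ℝ) : Prop :=
  ∀ᵐ z ∂(P.prod (volume.restrict Q)), ConvexOn ℝ univ (V z.1 z.2)

/-- Degenerate `p`-growth with a random weight `lam ∈ L^1(Ω)`. In the moment condition the power
`lam^(-1/(p-1))` is taken in `[0,∞]`, so that finiteness of the moment forces `lam > 0` almost
surely. -/
def DegenerateGrowth {Ω : Type*} [MeasurableSpace Ω] (P : Measure Ω) {d : ℕ} (p : ℝ)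
    (Q : Set (E d)) (V : Ω → E d → E d → ℝ) : Prop :=
  ∃ (C : ℝ) (lam : Ω → ℝ), 0 < C ∧ Integrable lam P ∧
    (∫⁻ ω, (ENNReal.ofReal (lam ω)) ^ (-(1 / (p - 1))) ∂P) ^ (p - 1) < ENNReal.ofReal C ∧
    ∀ᵐ z ∂(P.prod (volume.restrict Q)), ∀ F : E d,
      lam z.1 * ‖F‖ ^ p - C ≤ V z.1 z.2 F ∧ V z.1 z.2 F ≤ C * (lam z.1 * ‖F‖ ^ p + 1)

/-! ### Homogenized integrands -/

/-- `V_hom(x,F) = inf_{χ ∈ L^p_pot} ⟨V(ω,x,F+χ(ω))⟩`. -/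
def Vhom {Ω : Type*} [MeasurableSpace Ω] (P : Measure Ω) {d : ℕ} (τ : E d → Ω → Ω) (p : ℝ)
    (V : Ω → E d → E d → ℝ) (x F : E d) : EReal :=
  ⨅ χ ∈ Lpot P τ p, extIntegral P (fun ω => ((V ω x (F + χ ω) : ℝ) : EReal))

/-- `V_{hom,δ}(x,F) = inf_{χ ∈ L^p_pot} ⟨V(ω,x,F+χ(ω)) + δ |χ(ω)|^p⟩`. -/
def VhomReg {Ω : Type*} [MeasurableSpace Ω] (P : Measure Ω) {d : ℕ} (τ : E d → Ω → Ω) (p : ℝ)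
    (V : Ω → E d → E d → ℝ) (δ : ℝ) (x F : E d) : EReal :=
  ⨅ χ ∈ Lpot P τ p,
    extIntegral P (fun ω => ((V ω x (F + χ ω) + δ * ‖χ ω‖ ^ p : ℝ) : EReal))

/-! ### Sobolev functions with zero boundary values and integral functionals -/

/-- Test functions `C_c^∞(Q)`. -/
def IsTestFun {d : ℕ} (Q : Set (E d)) (η : E d → ℝ) : Prop :=
  ContDiff ℝ (⊤ : ℕ∞) η ∧ HasCompactSupport η ∧ tsupport η ⊆ Q

/-- `u ∈ W^{1,p}(Q)` with weak gradient `G`. -/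
def HasWeakGrad {d : ℕ} (Q : Set (E d)) (p : ℝ) (u : E d → ℝ) (G : E d → E d) : Prop :=
  MemLp u (ENNReal.ofReal p) (volume.restrict Q) ∧
  MemLp G (ENNReal.ofReal p) (volume.restrict Q) ∧
  ∀ η : E d → ℝ, IsTestFun Q η →
    ∫ x in Q, u x • gradient η x = - ∫ x in Q, η x • G x

/-- `u ∈ W^{1,p}_0(Q)`, the closure of `C_c^∞(Q)` in `W^{1,p}(Q)`, with weak gradient `G`. -/
def HasWeakGradZero {d : ℕ} (Q : Set (E d)) (p : ℝ) (u : E d → ℝ) (G : E d → E d) : Prop :=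
  HasWeakGrad Q p u G ∧ ∀ ε : ℝ≥0∞, 0 < ε → ∃ η : E d → ℝ, IsTestFun Q η ∧
    eLpNorm (fun x => u x - η x) (ENNReal.ofReal p) (volume.restrict Q) < ε ∧
    eLpNorm (fun x => G x - gradient η x) (ENNReal.ofReal p) (volume.restrict Q) < ε

/-- The functional `L^1(Q) → ℝ ∪ {∞}`, `u ↦ ∫_Q W(x,∇u(x)) dx` for `u ∈ W^{1,p}_0(Q)`, and `∞`
otherwise. The weak gradient is unique up to null sets, so the choice of its representative does
not matter. -/
def energy {d : ℕ} (Q : Set (E d)) (p : ℝ) (W : E d → E d → EReal)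
    (u : Lp ℝ 1 (volume.restrict Q)) : EReal :=
  open Classical in
  if h : ∃ G : E d → E d, HasWeakGradZero Q p u G then
    extIntegral (volume.restrict Q) (fun x => W x (h.choose x))
  else ⊤

/-- The homogenized functional `𝓔_hom`. -/
def Ehom {Ω : Type*} [MeasurableSpace Ω] (P : Measure Ω) {d : ℕ} (τ : E d → Ω → Ω) (p : ℝ)
    (Q : Set (E d)) (V : Ω → E d → E d → ℝ) : Lp ℝ 1 (volume.restrict Q) → EReal :=
  energy Q p (Vhom P τ p V)

/-- The regularized homogenized functional `𝓔_{hom,δ}`. -/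
def EhomReg {Ω : Type*} [MeasurableSpace Ω] (P : Measure Ω) {d : ℕ} (τ : E d → Ω → Ω) (p : ℝ)
    (Q : Set (E d)) (V : Ω → E d → E d → ℝ) (δ : ℝ) : Lp ℝ 1 (volume.restrict Q) → EReal :=
  energy Q p (VhomReg P τ p V δ)

/-- Mosco convergence of functionals `Φ δ` to `Φ₀` as `δ → 0+` on a normed space `X`: liminf
inequality along weakly convergent families, and existence of strongly convergent recovery
families. -/
def MoscoTendsto {X : Type*} [NormedAddCommGroup X] [NormedSpace ℝ X]
    (Φ : ℝ → X → EReal) (Φ₀ : X → EReal) : Prop :=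
  (∀ (u : ℝ → X) (u₀ : X),
    (∀ ℓ : StrongDual ℝ X, Tendsto (fun δ => ℓ (u δ)) (𝓝[>] 0) (𝓝 (ℓ u₀))) →
      Φ₀ u₀ ≤ liminf (fun δ => Φ δ (u δ)) (𝓝[>] 0)) ∧
  (∀ u₀ : X, ∃ u : ℝ → X, Tendsto u (𝓝[>] 0) (𝓝 u₀) ∧
    Tendsto (fun δ => Φ δ (u δ)) (𝓝[>] 0) (𝓝 (Φ₀ u₀)))

end StochHom

end

/-!
Write `V_hom = V_{hom,0}`, so that all parameters `δ ≥ 0` are treated at once.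

*Pointwise convergence.* `V_{hom,δ}` is nondecreasing in `δ`, and for a fixed potential field `χ` the
energy `⟨V(F+χ) + δ|χ|^p⟩` tends to `⟨V(F+χ)⟩` (`eventually_extIntegral_add_lt`). Exchanging the two
infima over `δ` and `χ` gives the limit at every point `x`, even where `V(·,x,F)` is not integrable
(`tendsto_vhomReg`).

*The effective density.* At a typical `x` only fields with `⟨lam |χ|^p⟩ < ∞` have finite energy.
These are exactly the fields `χ = (1+|lam|)^(-1/p) ψ` with `ψ ∈ L^p(Ω)^d`, and in terms of `ψ` the
mean energy is a finite convex function which is bounded on balls, hence continuous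
(`continuous_meanEnergy`). Since potential fields have mean zero, Hölder's inequality against the
weight bounds the mean energy from below by `C⁻¹|F|^p - C` (`le_meanEnergy`). So `V_{hom,δ}(x,·)` is
finite, convex and of `p`-growth. As `L^p(Ω)` is separable, the infimum over `ψ` is a countable one,
which makes `x ↦ V_{hom,δ}(x,G(x))` measurable (`aemeasurable_homReal`). Therefore
`g ↦ ∫_Q V_{hom,δ}(x,g(x)) dx` is a convex, coercive, continuous functional on `L^p(Q)^d`.

*Mosco convergence.* Constant families are recovery families, by dominated convergence. As
`𝓔_hom ≤ 𝓔_{hom,δ}`, the lower bound follows once `𝓔_hom` is weakly lower semicontinuous on `L^1(Q)`,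
and by Hahn-Banach it suffices that its sublevel sets, which are convex, are norm closed. A sublevel
set is the projection to `L^1(Q)` of a set of pairs `(u,∇u)` in `L^1(Q) × L^p(Q)^d`; this set is closed
and convex because `W^{1,p}_0(Q)` is the closure of the pairs `(η,∇η)` of test functions
(`hasWeakGradZero_iff_mem_closure`, which rests on Poincaré's inequality). Its second components are
bounded by coercivity, and in a uniformly convex space this makes the projection closed
(`exists_mem_of_mem_closure_fst_image`).
-/

set_option linter.unusedSectionVars false

namespace StochHom

/-! ### Extended integrals -/

section ExtIntegral

variable {α : Type*} [MeasurableSpace α] {μ : Measure α}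

lemma extIntegral_mono_ae {f g : α → EReal} (h : ∀ᵐ a ∂μ, f a ≤ g a) :
    extIntegral μ f ≤ extIntegral μ g := by
  refine EReal.sub_le_sub ?_ ?_
  · refine EReal.coe_ennreal_le_coe_ennreal_iff.2 (lintegral_mono_ae ?_)
    filter_upwards [h] with a ha using EReal.toENNReal_le_toENNReal ha
  · refine EReal.coe_ennreal_le_coe_ennreal_iff.2 (lintegral_mono_ae ?_)
    filter_upwards [h] with a ha using EReal.toENNReal_le_toENNReal (EReal.neg_le_neg_iff.2 ha)

lemma extIntegral_congr_ae {f g : α → EReal} (h : ∀ᵐ a ∂μ, f a = g a) :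
    extIntegral μ f = extIntegral μ g :=
  le_antisymm (extIntegral_mono_ae (h.mono fun _ ha => ha.le))
    (extIntegral_mono_ae (h.mono fun _ ha => ha.ge))

lemma extIntegral_coe_eq (f : α → ℝ) :
    extIntegral μ (fun a => (f a : EReal)) =
      ((∫⁻ a, ENNReal.ofReal (f a) ∂μ : ℝ≥0∞) : EReal)
        - ((∫⁻ a, ENNReal.ofReal (-f a) ∂μ : ℝ≥0∞) : EReal) := by
  simp only [extIntegral, EReal.real_coe_toENNReal, ← EReal.coe_neg]

lemma extIntegral_coe {f : α → ℝ} (hf : Integrable f μ) :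
    extIntegral μ (fun a => (f a : EReal)) = ((∫ a, f a ∂μ : ℝ) : EReal) := by
  have h1 : ∫⁻ a, ENNReal.ofReal (f a) ∂μ ≠ ⊤ := hf.lintegral_lt_top.ne
  have h2 : ∫⁻ a, ENNReal.ofReal (-f a) ∂μ ≠ ⊤ := hf.neg.lintegral_lt_top.ne
  rw [extIntegral_coe_eq, integral_eq_lintegral_pos_part_sub_lintegral_neg_part hf, EReal.coe_sub,
    ← EReal.coe_ennreal_toReal h1, ← EReal.coe_ennreal_toReal h2]

lemma extIntegral_eq_top [IsFiniteMeasure μ] {f : α → ℝ} {c : ℝ} (hc : ∀ᵐ a ∂μ, c ≤ f a)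
    (hf : ∫⁻ a, ENNReal.ofReal (f a) ∂μ = ⊤) :
    extIntegral μ (fun a => (f a : EReal)) = ⊤ := by
  rw [extIntegral_coe_eq, hf]
  have : ∫⁻ a, ENNReal.ofReal (-f a) ∂μ ≠ ⊤ := by
    refine ne_top_of_le_ne_top (b := ∫⁻ _, ENNReal.ofReal (-c) ∂μ) ?_ (lintegral_mono_ae ?_)
    · simp [ENNReal.mul_eq_top]
    · filter_upwards [hc] with a ha using ENNReal.ofReal_le_ofReal (by linarith)
  rw [← EReal.coe_ennreal_toReal this, EReal.coe_ennreal_top, EReal.top_sub_coe]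

/-- No measurability of `f` is needed: both parts of the extended integral are lower integrals,
which are additive as soon as one of the summands is measurable. -/
lemma eventually_extIntegral_add_lt {f g : α → ℝ} (hg : Integrable g μ)
    {b : EReal} (hb : extIntegral μ (fun a => (f a : EReal)) < b) :
    ∀ᶠ δ : ℝ in 𝓝[>] 0, extIntegral μ (fun a => ((f a + δ * g a : ℝ) : EReal)) < b := by
  rw [extIntegral_coe_eq] at hb
  set A := ∫⁻ a, ENNReal.ofReal (f a) ∂μ with hA
  set B := ∫⁻ a, ENNReal.ofReal (-f a) ∂μ with hB
  set K := ∫⁻ a, ENNReal.ofReal (g a) ∂μ with hK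
  have hKtop : K ≠ ⊤ := hg.lintegral_lt_top.ne
  have hgm : AEMeasurable (fun a => ENNReal.ofReal (g a)) μ := hg.1.aemeasurable.ennreal_ofReal
  have hpos : ∀ δ : ℝ, 0 < δ →
      ∫⁻ a, ENNReal.ofReal (f a + δ * g a) ∂μ ≤ A + ENNReal.ofReal δ * K := by
    intro δ hδ
    rw [hK, ← lintegral_const_mul'' _ hgm, hA, ← lintegral_add_right' _ (hgm.const_mul _)]
    refine lintegral_mono fun a => ?_
    rw [← ENNReal.ofReal_mul hδ.le]
    exact ENNReal.ofReal_add_le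
  have hneg : ∀ δ : ℝ, 0 < δ →
      B ≤ (∫⁻ a, ENNReal.ofReal (-(f a + δ * g a)) ∂μ) + ENNReal.ofReal δ * K := by
    intro δ hδ
    rw [hK, ← lintegral_const_mul'' _ hgm, hB, ← lintegral_add_right' _ (hgm.const_mul _)]
    refine lintegral_mono fun a => ?_
    rw [← ENNReal.ofReal_mul hδ.le]
    refine le_trans (le_of_eq ?_) ENNReal.ofReal_add_le
    congr 1; ring
  -- If `∫ f⁻ = ∞`, adding `δ g` cannot make it finite, and both extended integrals are `-∞`.
  by_cases hBt : B = ⊤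
  · filter_upwards [self_mem_nhdsWithin] with δ hδ
    have h := hneg δ hδ
    rw [hBt, top_le_iff, ENNReal.add_eq_top] at h
    rcases h with h | h
    · rw [extIntegral_coe_eq, h, EReal.coe_ennreal_top, EReal.sub_top]
      exact lt_of_le_of_lt bot_le hb
    · exact absurd h (ENNReal.mul_ne_top ENNReal.ofReal_ne_top hKtop)
  by_cases hAt : A = ⊤
  · rw [hAt, ← EReal.coe_ennreal_toReal hBt, EReal.coe_ennreal_top, EReal.top_sub_coe] at hb
    exact absurd hb not_top_lt
  rw [← EReal.coe_ennreal_toReal hBt, ← EReal.coe_ennreal_toReal hAt,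
    ← EReal.coe_sub] at hb
  have hlim : Tendsto (fun δ : ℝ => ((A.toReal - B.toReal + 2 * δ * K.toReal : ℝ) : EReal))
      (𝓝[>] 0) (𝓝 ((A.toReal - B.toReal : ℝ) : EReal)) := by
    refine (continuous_coe_real_ereal.tendsto _).comp (tendsto_nhdsWithin_of_tendsto_nhds ?_)
    have : Continuous fun δ : ℝ => A.toReal - B.toReal + 2 * δ * K.toReal := by fun_prop
    simpa using this.tendsto 0
  filter_upwards [hlim.eventually (gt_mem_nhds hb), self_mem_nhdsWithin] with δ hδb hδ
  have hδ : 0 < δ := hδ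
  refine lt_of_le_of_lt ?_ hδb
  rw [extIntegral_coe_eq]
  have h1 := hpos δ hδ
  have h2 := hneg δ hδ
  set A' := ∫⁻ a, ENNReal.ofReal (f a + δ * g a) ∂μ
  set B' := ∫⁻ a, ENNReal.ofReal (-(f a + δ * g a)) ∂μ
  have hδK : ENNReal.ofReal δ * K ≠ ⊤ := ENNReal.mul_ne_top ENNReal.ofReal_ne_top hKtop
  have hA't : A' ≠ ⊤ := ne_top_of_le_ne_top (ENNReal.add_ne_top.2 ⟨hAt, hδK⟩) h1
  by_cases hB't : B' = ⊤
  · rw [hB't, EReal.coe_ennreal_top, EReal.sub_top]; exact bot_le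
  have h1' := ENNReal.toReal_mono (ENNReal.add_ne_top.2 ⟨hAt, hδK⟩) h1
  have h2' := ENNReal.toReal_mono (ENNReal.add_ne_top.2 ⟨hB't, hδK⟩) h2
  rw [ENNReal.toReal_add hAt hδK, ENNReal.toReal_mul, ENNReal.toReal_ofReal hδ.le] at h1'
  rw [ENNReal.toReal_add hB't hδK, ENNReal.toReal_mul, ENNReal.toReal_ofReal hδ.le] at h2'
  rw [← EReal.coe_ennreal_toReal hB't, ← EReal.coe_ennreal_toReal hA't, ← EReal.coe_sub]
  exact EReal.coe_le_coe_iff.2 (by linarith)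

end ExtIntegral

/-! ### Convergence of the homogenized integrand at every point -/

section Pointwise

variable {Ω : Type*} [MeasurableSpace Ω] {P : Measure Ω} {d : ℕ} {τ : E d → Ω → Ω} {p : ℝ}
  {V : Ω → E d → E d → ℝ}

lemma vhomReg_zero : VhomReg P τ p V 0 = Vhom P τ p V := by
  funext x F
  simp [VhomReg, Vhom]

lemma vhom_le_vhomReg {δ : ℝ} (hδ : 0 ≤ δ) (x F : E d) :
    Vhom P τ p V x F ≤ VhomReg P τ p V δ x F := by
  refine iInf₂_mono fun χ _ => extIntegral_mono_ae (.of_forall fun ω => ?_)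
  exact EReal.coe_le_coe_iff.2 (le_add_of_nonneg_right (by positivity))

lemma integrable_rpow_of_mem_Lpot (hp : 1 < p) {χ : Ω → E d} (hχ : χ ∈ Lpot P τ p) :
    Integrable (fun ω => ‖χ ω‖ ^ p) P := by
  have := hχ.1.integrable_norm_rpow (by simpa using zero_lt_one.trans hp) ENNReal.ofReal_ne_top
  rwa [ENNReal.toReal_ofReal (by linarith)] at this

lemma tendsto_vhomReg (hp : 1 < p) (x F : E d) :
    Tendsto (fun δ : ℝ => VhomReg P τ p V δ x F) (𝓝[>] 0) (𝓝 (Vhom P τ p V x F)) := by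
  rw [tendsto_order]
  refine ⟨fun a ha => ?_, fun a ha => ?_⟩
  · filter_upwards [self_mem_nhdsWithin] with δ hδ
    exact ha.trans_le (vhom_le_vhomReg (le_of_lt hδ) x F)
  · obtain ⟨χ, hχ, hlt⟩ : ∃ χ ∈ Lpot P τ p,
        extIntegral P (fun ω => ((V ω x (F + χ ω) : ℝ) : EReal)) < a := by
      simpa [Vhom, iInf_lt_iff] using ha
    filter_upwards [eventually_extIntegral_add_lt (integrable_rpow_of_mem_Lpot hp hχ) hlt] with δ hδ
    exact (iInf₂_le χ hχ).trans_lt hδ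

end Pointwise

/-! ### Potential fields -/

section Potential

variable {Ω : Type*} [MeasurableSpace Ω] {P : Measure Ω} {d : ℕ} {τ : E d → Ω → Ω} {p : ℝ}

lemma IsDynamicalSystem.measurePreserving (hτ : IsDynamicalSystem P τ) (x : E d) :
    MeasurePreserving (τ x) P P := by
  refine ⟨hτ.measurable x, Measure.ext fun A hA => ?_⟩
  rw [Measure.map_apply (hτ.measurable x) hA, ← hτ.measure_image x A hA]
  have h1 : ∀ ω, τ x (τ (-x) ω) = ω := fun ω => by
    have := congrFun (hτ.add x (-x)) ω
    simpa [hτ.zero] using this.symm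
  have h2 : ∀ ω, τ (-x) (τ x ω) = ω := fun ω => by
    have := congrFun (hτ.add (-x) x) ω
    simpa [hτ.zero] using this.symm
  congr 1
  ext ω
  constructor
  · intro h
    exact ⟨τ x ω, h, h2 ω⟩
  · rintro ⟨ω', h, rfl⟩
    simpa [h1] using h

lemma HasStochGrad.aestronglyMeasurable_quotient (hτ : IsDynamicalSystem P τ) {φ : Ω → ℝ}
    {Ψ : Ω → E d} (h : HasStochGrad P τ p φ Ψ) (i : Fin d) (t : ℝ) :
    AEStronglyMeasurable
      (fun ω => t⁻¹ * (φ (τ (EuclideanSpace.single i t) ω) - φ ω) - Ψ ω i) P := by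
  have h1 := h.1.1.comp_measurePreserving (hτ.measurePreserving (EuclideanSpace.single i t))
  have h2 : AEStronglyMeasurable (fun ω => Ψ ω i) P :=
    (EuclideanSpace.proj (𝕜 := ℝ) i).continuous.comp_aestronglyMeasurable h.2.1.1
  exact ((h1.sub h.1.1).const_mul _).sub h2

lemma HasStochGrad.combo (hp : 1 < p) (hτ : IsDynamicalSystem P τ) {φ φ' : Ω → ℝ}
    {Ψ Ψ' : Ω → E d} (h : HasStochGrad P τ p φ Ψ) (h' : HasStochGrad P τ p φ' Ψ') (a b : ℝ) :
    HasStochGrad P τ p (fun ω => a * φ ω + b * φ' ω) (fun ω => a • Ψ ω + b • Ψ' ω) := by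
  refine ⟨(h.1.const_mul a).add (h'.1.const_mul b),
    (h.2.1.const_smul a).add (h'.2.1.const_smul b), fun i => ?_⟩
  have hlim : Tendsto (fun t : ℝ =>
      ‖a‖ₑ * eLpNorm (fun ω => t⁻¹ * (φ (τ (EuclideanSpace.single i t) ω) - φ ω) - Ψ ω i)
        (ENNReal.ofReal p) P +
      ‖b‖ₑ * eLpNorm (fun ω => t⁻¹ * (φ' (τ (EuclideanSpace.single i t) ω) - φ' ω) - Ψ' ω i)
        (ENNReal.ofReal p) P) (𝓝[≠] 0) (𝓝 0) := by
    simpa using (ENNReal.Tendsto.const_mul (h.2.2 i) (Or.inr enorm_ne_top)).add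
      (ENNReal.Tendsto.const_mul (h'.2.2 i) (Or.inr enorm_ne_top))
  refine tendsto_of_tendsto_of_tendsto_of_le_of_le tendsto_const_nhds hlim
    (fun _ => zero_le) fun t => ?_
  simp only
  rw [← eLpNorm_const_smul, ← eLpNorm_const_smul]
  refine le_trans (le_of_eq ?_) (eLpNorm_add_le
    ((h.aestronglyMeasurable_quotient hτ i t).const_smul a)
    ((h'.aestronglyMeasurable_quotient hτ i t).const_smul b) ?_)
  · congr 1
    funext ω
    simp
    ring
  · rw [← ENNReal.ofReal_one]; exact ENNReal.ofReal_le_ofReal hp.le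

lemma hasStochGrad_zero : HasStochGrad P τ p (fun _ => 0) (fun _ => (0 : E d)) := by
  refine ⟨MemLp.zero, MemLp.zero, fun i => ?_⟩
  simp

lemma zero_mem_Lpot : (fun _ => (0 : E d)) ∈ Lpot P τ p :=
  ⟨MemLp.zero, fun ε hε => ⟨_, _, hasStochGrad_zero, by simpa using hε⟩⟩

lemma Lpot_congr {χ χ' : Ω → E d} (h : χ =ᵐ[P] χ') (hχ : χ ∈ Lpot P τ p) : χ' ∈ Lpot P τ p := by
  refine ⟨hχ.1.ae_eq h, fun ε hε => ?_⟩
  obtain ⟨φ, Ψ, h1, h2⟩ := hχ.2 ε hε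
  refine ⟨φ, Ψ, h1, ?_⟩
  rwa [← eLpNorm_congr_ae (f := fun ω => χ ω - Ψ ω) (h.mono fun ω hω => by simp only [hω])]

lemma Lpot_combo (hp : 1 < p) (hτ : IsDynamicalSystem P τ) {χ χ' : Ω → E d}
    (hχ : χ ∈ Lpot P τ p) (hχ' : χ' ∈ Lpot P τ p) (a b : ℝ) :
    (fun ω => a • χ ω + b • χ' ω) ∈ Lpot P τ p := by
  refine ⟨(hχ.1.const_smul a).add (hχ'.1.const_smul b), fun ε hε => ?_⟩
  have hp1 : 1 ≤ ENNReal.ofReal p := by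
    rw [← ENNReal.ofReal_one]; exact ENNReal.ofReal_le_ofReal hp.le
  obtain ⟨η, hη, hηε⟩ : ∃ η : ℝ≥0∞, 0 < η ∧ ‖a‖ₑ * η + ‖b‖ₑ * η < ε := by
    have h0 : Tendsto ENNReal.ofReal (𝓝[>] 0) (𝓝 0) := by
      simpa using (ENNReal.continuous_ofReal.tendsto 0).mono_left nhdsWithin_le_nhds
    have hlim : Tendsto (fun t : ℝ => ‖a‖ₑ * ENNReal.ofReal t + ‖b‖ₑ * ENNReal.ofReal t)
        (𝓝[>] 0) (𝓝 0) := by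
      simpa using (ENNReal.Tendsto.const_mul h0 (Or.inr (enorm_ne_top (x := a)))).add
        (ENNReal.Tendsto.const_mul h0 (Or.inr (enorm_ne_top (x := b))))
    obtain ⟨t, ht, ht0⟩ := ((hlim.eventually (gt_mem_nhds hε)).and self_mem_nhdsWithin).exists
    exact ⟨ENNReal.ofReal t, ENNReal.ofReal_pos.2 ht0, ht⟩
  obtain ⟨φ, Ψ, h1, h2⟩ := hχ.2 η hη
  obtain ⟨φ', Ψ', h1', h2'⟩ := hχ'.2 η hη
  refine ⟨_, _, h1.combo hp hτ h1' a b, lt_of_le_of_lt ?_ hηε⟩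
  have e : (fun ω => a • χ ω + b • χ' ω - (a • Ψ ω + b • Ψ' ω)) =
      (a • fun ω => χ ω - Ψ ω) + (b • fun ω => χ' ω - Ψ' ω) := by
    funext ω
    simp only [Pi.add_apply, Pi.smul_apply, smul_sub]
    abel
  rw [e]
  refine (eLpNorm_add_le ((hχ.1.1.sub h1.2.1.1).const_smul a)
    ((hχ'.1.1.sub h1'.2.1.1).const_smul b) hp1).trans ?_
  rw [eLpNorm_const_smul, eLpNorm_const_smul]
  gcongr
  exacts [h2.le, h2'.le]

variable [IsProbabilityMeasure P]

lemma enorm_integral_le_eLpNorm {F : Type*} [NormedAddCommGroup F] [NormedSpace ℝ F] (hp : 1 < p)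
    {g : Ω → F} (hg : AEStronglyMeasurable g P) :
    ‖∫ ω, g ω ∂P‖ₑ ≤ eLpNorm g (ENNReal.ofReal p) P := by
  refine (enorm_integral_le_lintegral_enorm g).trans ?_
  rw [← eLpNorm_one_eq_lintegral_enorm]
  refine eLpNorm_le_eLpNorm_of_exponent_le ?_ hg
  rw [← ENNReal.ofReal_one]; exact ENNReal.ofReal_le_ofReal hp.le

lemma memLp_integrable {F : Type*} [NormedAddCommGroup F] {μ : Measure Ω} [IsFiniteMeasure μ]
    (hp : 1 < p) {g : Ω → F} (hg : MemLp g (ENNReal.ofReal p) μ) : Integrable g μ := by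
  refine hg.integrable ?_
  rw [← ENNReal.ofReal_one]; exact ENNReal.ofReal_le_ofReal hp.le

/-- Stochastic gradients have mean zero because the shifts preserve the measure. -/
lemma HasStochGrad.integral_eq_zero (hp : 1 < p) (hτ : IsDynamicalSystem P τ) {φ : Ω → ℝ}
    {Ψ : Ω → E d} (h : HasStochGrad P τ p φ Ψ) : ∫ ω, Ψ ω ∂P = 0 := by
  have hφ := memLp_integrable hp h.1
  have hΨ := memLp_integrable hp h.2.1
  ext i
  have hΨi : Integrable (fun ω => Ψ ω i) P :=
    (EuclideanSpace.proj (𝕜 := ℝ) i).integrable_comp hΨ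
  have e : (∫ ω, Ψ ω ∂P) i = ∫ ω, Ψ ω i ∂P :=
    ((EuclideanSpace.proj (𝕜 := ℝ) i).integral_comp_comm hΨ).symm
  rw [e]
  have key : ∀ t : ℝ, ‖∫ ω, Ψ ω i ∂P‖ₑ ≤
      eLpNorm (fun ω => t⁻¹ * (φ (τ (EuclideanSpace.single i t) ω) - φ ω) - Ψ ω i)
        (ENNReal.ofReal p) P := by
    intro t
    have hmp := hτ.measurePreserving (EuclideanSpace.single i t)
    have hφτ : Integrable (fun ω => φ (τ (EuclideanSpace.single i t) ω)) P :=
      hmp.integrable_comp_of_integrable hφ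
    have h0 : ∫ ω, φ (τ (EuclideanSpace.single i t) ω) ∂P = ∫ ω, φ ω ∂P := by
      conv_rhs => rw [← hmp.map_eq]
      rw [integral_map hmp.measurable.aemeasurable]
      rw [hmp.map_eq]
      exact hφ.1
    have h1 := enorm_integral_le_eLpNorm hp (h.aestronglyMeasurable_quotient hτ i t)
    have hq : Integrable
        (fun ω => t⁻¹ * (φ (τ (EuclideanSpace.single i t) ω) - φ ω)) P :=
      (hφτ.sub hφ).const_mul _
    rw [integral_sub hq hΨi, integral_const_mul, integral_sub hφτ hφ, h0]
      at h1
    simpa using h1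
  have := ge_of_tendsto' (h.2.2 i) key
  simpa using this

/-- The mean is continuous in `L^p(Ω)`, so it also vanishes on the closure of the stochastic
gradients. -/
lemma integral_eq_zero_of_mem_Lpot (hp : 1 < p) (hτ : IsDynamicalSystem P τ) {χ : Ω → E d}
    (hχ : χ ∈ Lpot P τ p) : ∫ ω, χ ω ∂P = 0 := by
  have : ∀ ε : ℝ≥0∞, 0 < ε → ‖∫ ω, χ ω ∂P‖ₑ ≤ ε := by
    intro ε hε
    obtain ⟨φ, Ψ, h1, h2⟩ := hχ.2 ε hε
    have h3 := enorm_integral_le_eLpNorm hp (hχ.1.1.sub h1.2.1.1)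
    simp only [Pi.sub_apply] at h3
    rw [integral_sub (memLp_integrable hp hχ.1) (memLp_integrable hp h1.2.1),
      h1.integral_eq_zero hp hτ, sub_zero] at h3
    exact h3.trans h2.le
  have h0 : ‖∫ ω, χ ω ∂P‖ₑ ≤ 0 := le_of_forall_gt_imp_ge_of_dense this
  simpa using h0

end Potential

/-! ### Carathéodory integrands and powers of the norm -/

section Caratheodory

/-- Superposition with a Carathéodory integrand: approximate `Φ` by simple functions. -/
lemma aemeasurable_comp_of_continuous {α X : Type*} [MeasurableSpace α] {μ : Measure α}
    [TopologicalSpace X] [TopologicalSpace.PseudoMetrizableSpace X] [MeasurableSpace X]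
    [BorelSpace X] {f : α → X → ℝ} (hf : ∀ F, AEMeasurable (fun a => f a F) μ)
    (hc : ∀ᵐ a ∂μ, Continuous (f a)) {Φ : α → X} (hΦ : AEStronglyMeasurable Φ μ) :
    AEMeasurable (fun a => f a (Φ a)) μ := by
  obtain ⟨Ψ, hΨ, hΦΨ⟩ := hΦ
  suffices h : AEMeasurable (fun a => f a (Ψ a)) μ from
    h.congr (hΦΨ.mono fun a ha => by simp only [ha])
  refine aemeasurable_of_tendsto_metrizable_ae (f := fun n a => f a (hΨ.approx n a)) atTop
    (fun n => ?_) ?_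
  · have e : (fun a => f a (hΨ.approx n a)) = fun a => ∑ F ∈ (hΨ.approx n).range,
        ((hΨ.approx n) ⁻¹' {F}).indicator (fun a => f a F) a := by
      funext a
      rw [Finset.sum_eq_single (hΨ.approx n a)]
      · simp
      · intro F _ hF
        exact indicator_of_notMem (fun h => hF (by simpa using h.symm)) _
      · intro h
        exact absurd (SimpleFunc.mem_range_self _ a) h
    rw [e]
    exact Finset.aemeasurable_fun_sum _ fun F _ =>
      (hf F).indicator ((hΨ.approx n).measurableSet_fiber F)
  · filter_upwards [hc] with a ha
    exact (ha.tendsto _).comp (hΨ.tendsto_approx a)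

lemma continuous_of_convexOn_univ {X : Type*} [NormedAddCommGroup X] [NormedSpace ℝ X]
    [FiniteDimensional ℝ X] {f : X → ℝ} (hf : ConvexOn ℝ univ f) : Continuous f :=
  continuousOn_univ.1 (hf.continuousOn isOpen_univ)

/-- A convex function which is bounded above on the unit ball is continuous everywhere. -/
lemma ConvexOn.continuous_of_bddAbove_ball {X : Type*} [NormedAddCommGroup X] [NormedSpace ℝ X]
    {f : X → ℝ} (hf : ConvexOn ℝ univ f) {M : ℝ} (hM : ∀ x, ‖x‖ ≤ 1 → f x ≤ M) :
    Continuous f := by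
  rw [← continuousOn_univ]
  have h := (hf.continuousOn_tfae isOpen_univ univ_nonempty).out 3 1
  refine h.1 ⟨0, mem_univ _, M, ?_⟩
  rw [eventually_map]
  filter_upwards [Metric.closedBall_mem_nhds (0 : X) one_pos] with x hx
  exact hM x (by simpa using hx)

lemma convexOn_norm_rpow {X : Type*} [NormedAddCommGroup X] [NormedSpace ℝ X] {p : ℝ}
    (hp : 1 < p) : ConvexOn ℝ univ fun x : X => ‖x‖ ^ p := by
  refine ⟨convex_univ, fun x _ y _ a b ha hb hab => ?_⟩
  have h1 : ‖a • x + b • y‖ ≤ a • ‖x‖ + b • ‖y‖ := by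
    simpa using convexOn_univ_norm.2 (mem_univ x) (mem_univ y) ha hb hab
  exact (Real.rpow_le_rpow (norm_nonneg _) h1 (by linarith)).trans
    ((convexOn_rpow hp.le).2 (norm_nonneg x) (norm_nonneg y) ha hb hab)

lemma norm_add_rpow_le {X : Type*} [NormedAddCommGroup X] {p : ℝ} (hp : 0 ≤ p) (x y : X) :
    ‖x + y‖ ^ p ≤ 2 ^ p * (‖x‖ ^ p + ‖y‖ ^ p) := by
  have h1 : ‖x + y‖ ≤ 2 * max ‖x‖ ‖y‖ := (norm_add_le x y).trans (by
    linarith [le_max_left ‖x‖ ‖y‖, le_max_right ‖x‖ ‖y‖])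
  refine (Real.rpow_le_rpow (norm_nonneg _) h1 hp).trans ?_
  rw [Real.mul_rpow (by norm_num) (le_max_of_le_left (norm_nonneg _))]
  gcongr
  rcases max_choice ‖x‖ ‖y‖ with h | h <;> rw [h]
  · exact le_add_of_nonneg_right (by positivity)
  · exact le_add_of_nonneg_left (by positivity)

lemma Lp_norm_rpow_eq {α X : Type*} [MeasurableSpace α] {μ : Measure α} [NormedAddCommGroup X]
    {p : ℝ} (hp : 1 < p) (g : Lp X (ENNReal.ofReal p) μ) :
    ‖g‖ ^ p = ∫ a, ‖g a‖ ^ p ∂μ := by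
  have h0 : ENNReal.ofReal p ≠ 0 := by simpa using zero_lt_one.trans hp
  have hp0 : 0 < p := by linarith
  rw [Lp.norm_def, (Lp.memLp g).eLpNorm_eq_integral_rpow_norm h0 ENNReal.ofReal_ne_top,
    ENNReal.toReal_ofReal hp0.le, ENNReal.toReal_ofReal (by positivity),
    Real.rpow_inv_rpow (by positivity) hp0.ne']

lemma Lp_integrable_norm_rpow {α X : Type*} [MeasurableSpace α] {μ : Measure α}
    [NormedAddCommGroup X] {p : ℝ} (hp : 1 < p) (g : Lp X (ENNReal.ofReal p) μ) :
    Integrable (fun a => ‖g a‖ ^ p) μ := by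
  have := (Lp.memLp g).integrable_norm_rpow (by simpa using zero_lt_one.trans hp)
    ENNReal.ofReal_ne_top
  rwa [ENNReal.toReal_ofReal (by linarith)] at this

end Caratheodory

/-! ### Mean energies under degenerate growth -/

section Weighted

variable {Ω : Type*} [MeasurableSpace Ω] {P : Measure Ω} {d : ℕ} {τ : E d → Ω → Ω} {p C : ℝ}
  {lam : Ω → ℝ} {f : Ω → E d → ℝ}

/-- The random weights admitted in the degenerate growth condition: integrable, with the moment
condition on `lam^(-1/(p-1))`. -/
structure IsAdmissibleWeight (P : Measure Ω) (p C : ℝ) (lam : Ω → ℝ) : Prop where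
  pos : 0 < C
  integrable : Integrable lam P
  moment : (∫⁻ ω, (ENNReal.ofReal (lam ω)) ^ (-(1 / (p - 1))) ∂P) ^ (p - 1) < ENNReal.ofReal C

/-- A convex integrand on `Ω` with degenerate `p`-growth: the section `V(·,x,·)` of an admissible
integrand at a typical point `x`. -/
structure IsDegenerateIntegrand (P : Measure Ω) (p C : ℝ) (lam : Ω → ℝ) (f : Ω → E d → ℝ) :
    Prop where
  aemeasurable : ∀ F, AEMeasurable (fun ω => f ω F) P
  convex : ∀ᵐ ω ∂P, ConvexOn ℝ univ (f ω)
  growth : ∀ᵐ ω ∂P, ∀ F, lam ω * ‖F‖ ^ p - C ≤ f ω F ∧ f ω F ≤ C * (lam ω * ‖F‖ ^ p + 1)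

/-- Where `lam ≤ 0` the integrand of the moment is `0^(negative) = ∞`. -/
lemma IsAdmissibleWeight.ae_pos (hw : IsAdmissibleWeight P p C lam) (hp : 1 < p) :
    ∀ᵐ ω ∂P, 0 < lam ω := by
  have hp1 : 0 < p - 1 := by linarith
  have hfin : ∫⁻ ω, (ENNReal.ofReal (lam ω)) ^ (-(1 / (p - 1))) ∂P ≠ ⊤ := by
    intro h
    have := hw.moment
    rw [h, ENNReal.top_rpow_of_pos hp1] at this
    exact absurd this not_top_lt
  filter_upwards [ae_lt_top' ((hw.integrable.1.aemeasurable.ennreal_ofReal).pow_const _) hfin]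
    with ω hω
  by_contra h
  rw [ENNReal.ofReal_of_nonpos (not_lt.1 h), ENNReal.zero_rpow_of_neg (by
    have : 0 < 1 / (p - 1) := by positivity
    linarith)] at hω
  exact absurd hω (lt_irrefl _)

/-- The damping factor `(1+|lam|)^(-1/p)`. Multiplication by it maps `L^p(Ω)` onto the set of
`χ ∈ L^p(Ω)` with `⟨lam |χ|^p⟩ < ∞`. -/
noncomputable def damp (p : ℝ) (lam : Ω → ℝ) (ω : Ω) : ℝ := (1 + |lam ω|) ^ (-(1 / p))

lemma damp_pos (ω : Ω) : 0 < damp p lam ω := Real.rpow_pos_of_pos (by positivity) _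

lemma damp_rpow (hp : 1 < p) (ω : Ω) : damp p lam ω ^ p = (1 + |lam ω|)⁻¹ := by
  have : (0 : ℝ) ≤ 1 + |lam ω| := by positivity
  rw [damp, ← Real.rpow_mul this, ← Real.rpow_neg_one]
  congr 1
  field_simp

lemma norm_damp_smul_rpow (hp : 1 < p) (ω : Ω) (x : E d) :
    ‖damp p lam ω • x‖ ^ p = (1 + |lam ω|)⁻¹ * ‖x‖ ^ p := by
  rw [norm_smul, Real.norm_of_nonneg (damp_pos ω).le, Real.mul_rpow (damp_pos ω).le (norm_nonneg _),
    damp_rpow hp]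

lemma norm_damp_smul_rpow_le (hp : 1 < p) (ω : Ω) (x : E d) :
    ‖damp p lam ω • x‖ ^ p ≤ ‖x‖ ^ p := by
  rw [norm_damp_smul_rpow hp]
  refine mul_le_of_le_one_left (by positivity) (inv_le_one_of_one_le₀ ?_)
  linarith [abs_nonneg (lam ω)]

lemma lam_mul_norm_damp_smul_rpow_le (hp : 1 < p) (ω : Ω) (x : E d) :
    lam ω * ‖damp p lam ω • x‖ ^ p ≤ ‖x‖ ^ p := by
  rw [norm_damp_smul_rpow hp, ← mul_assoc]
  refine mul_le_of_le_one_left (by positivity) ?_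
  rw [← div_eq_mul_inv, div_le_one (by positivity)]
  linarith [le_abs_self (lam ω)]

lemma IsAdmissibleWeight.aestronglyMeasurable_damp (hw : IsAdmissibleWeight P p C lam) :
    AEStronglyMeasurable (damp p lam) P :=
  ((hw.integrable.1.norm.aemeasurable.const_add 1).pow_const _).aestronglyMeasurable

lemma aestronglyMeasurable_damp_smul (hw : IsAdmissibleWeight P p C lam)
    (ψ : Lp (E d) (ENNReal.ofReal p) P) :
    AEStronglyMeasurable (fun ω => damp p lam ω • ψ ω) P :=
  hw.aestronglyMeasurable_damp.smul (Lp.aestronglyMeasurable ψ)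

lemma IsDegenerateIntegrand.aemeasurable_comp (hf : IsDegenerateIntegrand P p C lam f)
    {χ : Ω → E d} (hχ : AEStronglyMeasurable χ P) : AEMeasurable (fun ω => f ω (χ ω)) P :=
  aemeasurable_comp_of_continuous hf.aemeasurable
    (hf.convex.mono fun _ h => continuous_of_convexOn_univ h) hχ

variable [IsProbabilityMeasure P]

lemma IsDegenerateIntegrand.integrable_comp (hf : IsDegenerateIntegrand P p C lam f)
    (hw : IsAdmissibleWeight P p C lam) (hp : 1 < p)
    {χ : Ω → E d} (hχ : AEStronglyMeasurable χ P)
    (hχi : Integrable (fun ω => lam ω * ‖χ ω‖ ^ p) P) : Integrable (fun ω => f ω (χ ω)) P := by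
  have hC := hw.pos
  refine Integrable.mono' (g := fun ω => C * (lam ω * ‖χ ω‖ ^ p + 1) + C)
    (((hχi.add (integrable_const 1)).const_mul C).add (integrable_const C))
    (hf.aemeasurable_comp hχ).aestronglyMeasurable ?_
  filter_upwards [hf.growth, hw.ae_pos hp] with ω h1 h2
  have h3 : 0 ≤ lam ω * ‖χ ω‖ ^ p := by positivity
  have h4 : 0 ≤ C * (lam ω * ‖χ ω‖ ^ p) := by positivity
  rw [Real.norm_eq_abs, abs_le]
  constructor <;> nlinarith [h1 (χ ω)]

/-- Fields with infinite weighted energy have infinite energy. -/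
lemma IsDegenerateIntegrand.lintegral_comp_eq_top (hf : IsDegenerateIntegrand P p C lam f)
    (hw : IsAdmissibleWeight P p C lam) (hp : 1 < p)
    {χ : Ω → E d} (hχ : AEStronglyMeasurable χ P)
    (hχi : ¬ Integrable (fun ω => lam ω * ‖χ ω‖ ^ p) P) :
    ∫⁻ ω, ENNReal.ofReal (f ω (χ ω)) ∂P = ⊤ := by
  by_contra h
  apply hχi
  have hm : AEStronglyMeasurable (fun ω => lam ω * ‖χ ω‖ ^ p) P :=
    (hw.integrable.1.aemeasurable.mul (hχ.norm.aemeasurable.pow_const p)).aestronglyMeasurable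
  refine ⟨hm, ?_⟩
  rw [hasFiniteIntegral_iff_ofReal (by
    filter_upwards [hw.ae_pos hp] with ω h2
    have h3 : 0 ≤ lam ω * ‖χ ω‖ ^ p := by positivity
    exact h3)]
  refine lt_of_le_of_lt (b := ∫⁻ ω, (ENNReal.ofReal (f ω (χ ω)) + ENNReal.ofReal C) ∂P)
    (lintegral_mono_ae ?_) ?_
  · filter_upwards [hf.growth] with ω h1
    refine le_trans (ENNReal.ofReal_le_ofReal ?_) ENNReal.ofReal_add_le
    linarith [(h1 (χ ω)).1]
  · rw [lintegral_add_right _ measurable_const]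
    simpa using lt_top_iff_ne_top.2 h

lemma lam_mul_norm_rpow_le (hw : IsAdmissibleWeight P p C lam) (hp : 1 < p) :
    ∀ᵐ ω ∂P, ∀ x y : E d, lam ω * ‖x + y‖ ^ p ≤
      2 ^ p * (lam ω * ‖x‖ ^ p + lam ω * ‖y‖ ^ p) := by
  filter_upwards [hw.ae_pos hp] with ω h x y
  have := mul_le_mul_of_nonneg_left (norm_add_rpow_le (by linarith : 0 ≤ p) x y) h.le
  linarith

lemma integrable_lam_mul_add (hw : IsAdmissibleWeight P p C lam) (hp : 1 < p)
    {χ χ' : Ω → E d} (hχ : AEStronglyMeasurable χ P) (hχ' : AEStronglyMeasurable χ' P)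
    (h : Integrable (fun ω => lam ω * ‖χ ω‖ ^ p) P)
    (h' : Integrable (fun ω => lam ω * ‖χ' ω‖ ^ p) P) :
    Integrable (fun ω => lam ω * ‖χ ω + χ' ω‖ ^ p) P := by
  refine Integrable.mono' ((h.add h').const_mul (2 ^ p))
    (hw.integrable.1.aemeasurable.mul
      ((hχ.add hχ').norm.aemeasurable.pow_const p)).aestronglyMeasurable ?_
  filter_upwards [lam_mul_norm_rpow_le (d := d) hw hp, hw.ae_pos hp] with ω h1 h2
  rw [Real.norm_of_nonneg (by positivity)]
  exact h1 _ _

lemma integrable_lam_mul_damp (hw : IsAdmissibleWeight P p C lam) (hp : 1 < p)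
    (F : E d) (ψ : Lp (E d) (ENNReal.ofReal p) P) :
    Integrable (fun ω => lam ω * ‖F + damp p lam ω • ψ ω‖ ^ p) P := by
  refine integrable_lam_mul_add hw hp aestronglyMeasurable_const
    (aestronglyMeasurable_damp_smul hw ψ) (hw.integrable.mul_const _) ?_
  refine Integrable.mono' (Lp_integrable_norm_rpow hp ψ)
    (hw.integrable.1.aemeasurable.mul ((aestronglyMeasurable_damp_smul hw
      ψ).norm.aemeasurable.pow_const p)).aestronglyMeasurable ?_
  filter_upwards [hw.ae_pos hp] with ω h2
  rw [Real.norm_of_nonneg (by positivity)]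
  exact lam_mul_norm_damp_smul_rpow_le hp ω _

lemma integrable_norm_damp (hw : IsAdmissibleWeight P p C lam) (hp : 1 < p)
    (ψ : Lp (E d) (ENNReal.ofReal p) P) :
    Integrable (fun ω => ‖damp p lam ω • ψ ω‖ ^ p) P := by
  refine Integrable.mono' (Lp_integrable_norm_rpow hp ψ)
    ((aestronglyMeasurable_damp_smul hw ψ).norm.aemeasurable.pow_const p).aestronglyMeasurable
    (.of_forall fun ω => ?_)
  rw [Real.norm_of_nonneg (by positivity)]
  exact norm_damp_smul_rpow_le hp ω _

/-- The mean energy `⟨f(ω,F+χ) + δ|χ|^p⟩` of the field `χ = damp • ψ`, as a function of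
`(F,ψ) ∈ ℝ^d × L^p(Ω)^d`. In this parametrization it is finite, convex and continuous. -/
noncomputable def meanEnergy (P : Measure Ω) (p : ℝ) (lam : Ω → ℝ) (f : Ω → E d → ℝ) (δ : ℝ)
    (z : E d × Lp (E d) (ENNReal.ofReal p) P) : ℝ :=
  ∫ ω, (f ω (z.1 + damp p lam ω • z.2 ω) + δ * ‖damp p lam ω • z.2 ω‖ ^ p) ∂P

lemma IsDegenerateIntegrand.integrable_meanEnergy (hf : IsDegenerateIntegrand P p C lam f)
    (hw : IsAdmissibleWeight P p C lam) (hp : 1 < p) (δ : ℝ)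
    (z : E d × Lp (E d) (ENNReal.ofReal p) P) :
    Integrable (fun ω => f ω (z.1 + damp p lam ω • z.2 ω) + δ * ‖damp p lam ω • z.2 ω‖ ^ p) P :=
  (hf.integrable_comp hw hp (aestronglyMeasurable_const.add (aestronglyMeasurable_damp_smul hw z.2))
    (integrable_lam_mul_damp hw hp z.1 z.2)).add ((integrable_norm_damp hw hp z.2).const_mul δ)

variable [Fact (1 ≤ ENNReal.ofReal p)]

lemma IsDegenerateIntegrand.convexOn_meanEnergy (hf : IsDegenerateIntegrand P p C lam f)
    (hw : IsAdmissibleWeight P p C lam) (hp : 1 < p) {δ : ℝ} (hδ : 0 ≤ δ) :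
    ConvexOn ℝ univ (meanEnergy P p lam f δ) := by
  refine ⟨convex_univ, fun z _ z' _ a b ha hb hab => ?_⟩
  have hi := hf.integrable_meanEnergy hw hp δ z
  have hi' := hf.integrable_meanEnergy hw hp δ z'
  simp only [smul_eq_mul]
  unfold meanEnergy
  rw [← integral_const_mul, ← integral_const_mul, ← integral_add (hi.const_mul a) (hi'.const_mul b)]
  refine integral_mono_ae (hf.integrable_meanEnergy hw hp δ (a • z + b • z'))
    ((hi.const_mul a).add (hi'.const_mul b)) ?_
  have hco : ∀ᵐ ω ∂P, (a • z + b • z').2 ω = a • z.2 ω + b • z'.2 ω := by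
    filter_upwards [Lp.coeFn_add (a • z.2) (b • z'.2), Lp.coeFn_smul a z.2, Lp.coeFn_smul b z'.2]
      with ω h1 h2 h3
    simp only [Prod.snd_add, Prod.smul_snd, h1, Pi.add_apply, h2, h3, Pi.smul_apply]
  filter_upwards [hf.convex, hco] with ω hω h
  have e1 : damp p lam ω • (a • z + b • z').2 ω =
      a • (damp p lam ω • z.2 ω) + b • (damp p lam ω • z'.2 ω) := by
    rw [h, smul_add, smul_comm _ a, smul_comm _ b]
  have e2 : (a • z + b • z').1 + damp p lam ω • (a • z + b • z').2 ω =
      a • (z.1 + damp p lam ω • z.2 ω) + b • (z'.1 + damp p lam ω • z'.2 ω) := by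
    rw [e1]
    simp only [Prod.fst_add, Prod.smul_fst, smul_add]
    abel
  have c1 := hω.2 (mem_univ (z.1 + damp p lam ω • z.2 ω))
    (mem_univ (z'.1 + damp p lam ω • z'.2 ω)) ha hb hab
  have c2 := (convexOn_norm_rpow hp).2 (mem_univ (damp p lam ω • z.2 ω))
    (mem_univ (damp p lam ω • z'.2 ω)) ha hb hab
  rw [e2, e1]
  simp only [smul_eq_mul] at c1 c2
  nlinarith

lemma IsDegenerateIntegrand.meanEnergy_le (hf : IsDegenerateIntegrand P p C lam f)
    (hw : IsAdmissibleWeight P p C lam) (hp : 1 < p) {δ : ℝ} (hδ : 0 ≤ δ)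
    (z : E d × Lp (E d) (ENNReal.ofReal p) P) :
    meanEnergy P p lam f δ z ≤
      C * (2 ^ p * ((∫ ω, lam ω ∂P) * ‖z.1‖ ^ p + ‖z.2‖ ^ p) + 1) + δ * ‖z.2‖ ^ p := by
  have i1 := hw.integrable.mul_const (‖z.1‖ ^ p)
  have i2 := Lp_integrable_norm_rpow hp z.2
  have i3 : Integrable
      (fun ω => C * (2 ^ p * (lam ω * ‖z.1‖ ^ p + ‖z.2 ω‖ ^ p) + 1) + δ * ‖z.2 ω‖ ^ p) P :=
    ((((i1.add i2).const_mul _).add (integrable_const 1)).const_mul C).add (i2.const_mul δ)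
  have : ∫ ω, C * (2 ^ p * (lam ω * ‖z.1‖ ^ p + ‖z.2 ω‖ ^ p) + 1) + δ * ‖z.2 ω‖ ^ p ∂P =
      C * (2 ^ p * ((∫ ω, lam ω ∂P) * ‖z.1‖ ^ p + ‖z.2‖ ^ p) + 1) + δ * ‖z.2‖ ^ p := by
    have i4 : Integrable (fun ω => 2 ^ p * (lam ω * ‖z.1‖ ^ p + ‖z.2 ω‖ ^ p)) P :=
      (i1.add i2).const_mul _
    have i5 : Integrable (fun ω => 2 ^ p * (lam ω * ‖z.1‖ ^ p + ‖z.2 ω‖ ^ p) + 1) P :=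
      i4.add (integrable_const 1)
    rw [integral_add (i5.const_mul C) (i2.const_mul δ), integral_const_mul, integral_const_mul,
      integral_add i4 (integrable_const 1), integral_const_mul, integral_add i1 i2,
      integral_mul_const, Lp_norm_rpow_eq hp]
    simp
  rw [← this]
  refine integral_mono_ae (hf.integrable_meanEnergy hw hp δ z) i3 ?_
  filter_upwards [hf.growth, lam_mul_norm_rpow_le (d := d) hw hp] with ω h1 h2
  have h3 := (h1 (z.1 + damp p lam ω • z.2 ω)).2
  have h4 := h2 z.1 (damp p lam ω • z.2 ω)
  have h5 := lam_mul_norm_damp_smul_rpow_le (lam := lam) hp ω (z.2 ω)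
  have h6 := norm_damp_smul_rpow_le (lam := lam) hp ω (z.2 ω)
  have hC := hw.pos
  refine add_le_add (h3.trans ?_) (by gcongr)
  refine mul_le_mul_of_nonneg_left (add_le_add_left (h4.trans ?_) _) hC.le
  gcongr

lemma IsDegenerateIntegrand.continuous_meanEnergy (hf : IsDegenerateIntegrand P p C lam f)
    (hw : IsAdmissibleWeight P p C lam) (hp : 1 < p) {δ : ℝ} (hδ : 0 ≤ δ) :
    Continuous (meanEnergy P p lam f δ) := by
  have hC := hw.pos
  have hp0 : 0 ≤ p := by linarith
  have hl : 0 ≤ ∫ ω, lam ω ∂P :=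
    integral_nonneg_of_ae ((hw.ae_pos hp).mono fun _ h => h.le)
  refine ConvexOn.continuous_of_bddAbove_ball (hf.convexOn_meanEnergy hw hp hδ)
    (M := C * (2 ^ p * ((∫ ω, lam ω ∂P) * 1 + 1) + 1) + δ * 1) fun z hz => ?_
  have h1 : ‖z.1‖ ^ p ≤ 1 := Real.rpow_le_one (norm_nonneg _) ((norm_fst_le z).trans hz) hp0
  have h2 : ‖z.2‖ ^ p ≤ 1 := Real.rpow_le_one (norm_nonneg _) ((norm_snd_le z).trans hz) hp0
  refine (hf.meanEnergy_le hw hp hδ z).trans ?_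
  gcongr

end Weighted

/-! ### The homogenized value of a single integrand -/

section HomValue

variable {Ω : Type*} [MeasurableSpace Ω] {P : Measure Ω} {d : ℕ} {τ : E d → Ω → Ω} {p C : ℝ}
  {lam : Ω → ℝ} {f : Ω → E d → ℝ}

/-- The homogenized value of a single integrand `f` on `Ω`, so that `V_{hom,δ}(x,·)` is the
homogenized value of `V(·,x,·)`. -/
noncomputable def homValue (P : Measure Ω) (τ : E d → Ω → Ω) (p : ℝ) (f : Ω → E d → ℝ) (δ : ℝ)
    (F : E d) : EReal :=
  ⨅ χ ∈ Lpot P τ p, extIntegral P (fun ω => ((f ω (F + χ ω) + δ * ‖χ ω‖ ^ p : ℝ) : EReal))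

/-- The fields `ψ ∈ L^p` for which `damp • ψ` is a potential field. -/
def potSet (P : Measure Ω) (τ : E d → Ω → Ω) (p : ℝ) (lam : Ω → ℝ) :
    Set (Lp (E d) (ENNReal.ofReal p) P) :=
  {ψ | (fun ω => damp p lam ω • ψ ω) ∈ Lpot P τ p}

lemma zero_mem_potSet : (0 : Lp (E d) (ENNReal.ofReal p) P) ∈ potSet P τ p lam := by
  refine Lpot_congr ?_ zero_mem_Lpot
  filter_upwards [Lp.coeFn_zero (E d) (ENNReal.ofReal p) P] with ω h
  rw [h]
  simp

instance : Nonempty (potSet P τ p lam) := ⟨⟨0, zero_mem_potSet⟩⟩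

lemma combo_mem_potSet (hp : 1 < p) (hτ : IsDynamicalSystem P τ)
    {ψ ψ' : Lp (E d) (ENNReal.ofReal p) P} (hψ : ψ ∈ potSet P τ p lam)
    (hψ' : ψ' ∈ potSet P τ p lam) (a b : ℝ) : a • ψ + b • ψ' ∈ potSet P τ p lam := by
  refine Lpot_congr ?_ (Lpot_combo hp hτ hψ hψ' a b)
  filter_upwards [Lp.coeFn_add (a • ψ) (b • ψ'), Lp.coeFn_smul a ψ, Lp.coeFn_smul b ψ']
    with ω h1 h2 h3
  simp only [h1, Pi.add_apply, h2, h3, Pi.smul_apply, smul_add]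
  rw [smul_comm _ a, smul_comm _ b]

/-- A field with finite weighted energy is of the form `damp • ψ`. -/
lemma exists_damp_smul_eq (hw : IsAdmissibleWeight P p C lam) (hp : 1 < p) {χ : Ω → E d}
    (hχ : MemLp χ (ENNReal.ofReal p) P) (hχi : Integrable (fun ω => lam ω * ‖χ ω‖ ^ p) P) :
    ∃ ψ : Lp (E d) (ENNReal.ofReal p) P, (fun ω => damp p lam ω • ψ ω) =ᵐ[P] χ := by
  have h0 : ENNReal.ofReal p ≠ 0 := by simpa using zero_lt_one.trans hp
  have hp0 : 0 ≤ p := by linarith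
  have hm : AEStronglyMeasurable (fun ω => (damp p lam ω)⁻¹ • χ ω) P :=
    hw.aestronglyMeasurable_damp.inv₀.smul hχ.1
  have hχp := hχ.integrable_norm_rpow h0 ENNReal.ofReal_ne_top
  rw [ENNReal.toReal_ofReal hp0] at hχp
  have hmem : MemLp (fun ω => (damp p lam ω)⁻¹ • χ ω) (ENNReal.ofReal p) P := by
    rw [← integrable_norm_rpow_iff hm h0 ENNReal.ofReal_ne_top, ENNReal.toReal_ofReal hp0]
    refine (hχp.add hχi.norm).congr (.of_forall fun ω => ?_)
    have hd := damp_pos (p := p) (lam := lam) ω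
    simp only [Pi.add_apply]
    rw [norm_smul, Real.mul_rpow (by positivity) (by positivity), norm_inv,
      Real.norm_of_nonneg hd.le, Real.inv_rpow hd.le, damp_rpow hp, inv_inv, norm_mul,
      Real.norm_of_nonneg (by positivity : 0 ≤ ‖χ ω‖ ^ p), Real.norm_eq_abs]
    ring
  refine ⟨hmem.toLp _, ?_⟩
  filter_upwards [hmem.coeFn_toLp] with ω h
  rw [h, smul_inv_smul₀ (damp_pos ω).ne']

variable [IsProbabilityMeasure P]

/-- Fields that are not of the form `damp • ψ` have energy `+∞` and may be dropped from the
infimum. -/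
lemma homValue_eq_iInf_meanEnergy (hf : IsDegenerateIntegrand P p C lam f)
    (hw : IsAdmissibleWeight P p C lam) (hp : 1 < p) {δ : ℝ} (hδ : 0 ≤ δ) (F : E d) :
    homValue P τ p f δ F =
      ⨅ ψ : potSet P τ p lam, ((meanEnergy P p lam f δ (F, ψ) : ℝ) : EReal) := by
  unfold homValue
  refine le_antisymm (le_iInf fun ψ => ?_) (le_iInf₂ fun χ hχ => ?_)
  · refine (iInf₂_le (fun ω => damp p lam ω • ψ.1 ω) ψ.2).trans (le_of_eq ?_)
    exact extIntegral_coe (hf.integrable_meanEnergy hw hp δ (F, ψ.1))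
  · by_cases hχi : Integrable (fun ω => lam ω * ‖χ ω‖ ^ p) P
    · obtain ⟨ψ, hψ⟩ := exists_damp_smul_eq hw hp hχ.1 hχi
      refine (iInf_le _ (⟨ψ, Lpot_congr hψ.symm hχ⟩ : potSet P τ p lam)).trans (le_of_eq ?_)
      refine (extIntegral_coe (hf.integrable_meanEnergy hw hp δ (F, ψ))).symm.trans ?_
      refine extIntegral_congr_ae (hψ.mono fun ω h => ?_)
      simp only at h ⊢
      rw [h]
    · have hm : AEStronglyMeasurable (fun ω => F + χ ω) P := aestronglyMeasurable_const.add hχ.1.1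
      have h1 : ¬ Integrable (fun ω => lam ω * ‖F + χ ω‖ ^ p) P := by
        intro h
        apply hχi
        have := integrable_lam_mul_add hw hp hm (aestronglyMeasurable_const (b := -F)) h
          (hw.integrable.mul_const _)
        simpa using this
      have h2 : extIntegral P (fun ω => ((f ω (F + χ ω) : ℝ) : EReal)) = ⊤ := by
        refine extIntegral_eq_top (c := -C) ?_ (hf.lintegral_comp_eq_top hw hp hm h1)
        filter_upwards [hf.growth, hw.ae_pos hp] with ω h3 h4
        have h5 : 0 ≤ lam ω * ‖F + χ ω‖ ^ p := by positivity
        linarith [(h3 (F + χ ω)).1]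
      refine le_top.trans (h2.ge.trans (extIntegral_mono_ae (.of_forall fun ω => ?_)))
      exact EReal.coe_le_coe_iff.2 (le_add_of_nonneg_right (by positivity))

/-- Hölder's inequality against the weight: `‖⟨h⟩‖^p ≤ C ⟨lam |h|^p⟩`. -/
lemma norm_integral_rpow_le (hw : IsAdmissibleWeight P p C lam) (hp : 1 < p) {h : Ω → E d}
    (hm : AEStronglyMeasurable h P) (hi : Integrable (fun ω => lam ω * ‖h ω‖ ^ p) P) :
    ‖∫ ω, h ω ∂P‖ ^ p ≤ C * ∫ ω, lam ω * ‖h ω‖ ^ p ∂P := by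
  have hp0 : 0 < p := by linarith
  have hp1 : 0 < p - 1 := by linarith
  have hpq : p.HolderConjugate (p / (p - 1)) := Real.HolderConjugate.conjExponent hp
  set L : Ω → ℝ≥0∞ := fun ω => ENNReal.ofReal (lam ω) with hL
  have hLm : AEMeasurable L P := hw.integrable.1.aemeasurable.ennreal_ofReal
  have hpos := hw.ae_pos hp
  -- The factorization `h = (lam^(1/p) h) · lam^(-1/p)`.
  have hHol := ENNReal.lintegral_mul_le_Lp_mul_Lq P hpq
    (f := fun ω => L ω ^ (1 / p) * ‖h ω‖ₑ) (g := fun ω => L ω ^ (-(1 / p)))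
    ((hLm.pow_const _).mul hm.enorm) (hLm.pow_const _)
  have e1 : ∫⁻ ω, ((fun ω => L ω ^ (1 / p) * ‖h ω‖ₑ) * fun ω => L ω ^ (-(1 / p))) ω ∂P =
      ∫⁻ ω, ‖h ω‖ₑ ∂P := by
    refine lintegral_congr_ae ?_
    filter_upwards [hpos] with ω hω
    have h0 : L ω ≠ 0 := by simpa [hL] using hω
    have ht : L ω ≠ ⊤ := ENNReal.ofReal_ne_top
    simp only [Pi.mul_apply]
    rw [mul_right_comm, ← ENNReal.rpow_add _ _ h0 ht]
    simp
  have e2 : ∫⁻ ω, (L ω ^ (1 / p) * ‖h ω‖ₑ) ^ p ∂P =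
      ENNReal.ofReal (∫ ω, lam ω * ‖h ω‖ ^ p ∂P) := by
    rw [ofReal_integral_eq_lintegral_ofReal hi (by
      filter_upwards [hpos] with ω hω
      exact mul_nonneg hω.le (by positivity))]
    refine lintegral_congr_ae ?_
    filter_upwards [hpos] with ω hω
    rw [ENNReal.mul_rpow_of_nonneg _ _ hp0.le, ← ENNReal.rpow_mul, one_div,
      inv_mul_cancel₀ hp0.ne', ENNReal.rpow_one, ENNReal.ofReal_mul hω.le, ← ofReal_norm,
      ENNReal.ofReal_rpow_of_nonneg (norm_nonneg _) hp0.le]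
  have e3 : ∫⁻ ω, (L ω ^ (-(1 / p))) ^ (p / (p - 1)) ∂P = ∫⁻ ω, L ω ^ (-(1 / (p - 1))) ∂P := by
    refine lintegral_congr fun ω => ?_
    rw [← ENNReal.rpow_mul]
    congr 1
    field_simp
  rw [e1, e2, e3] at hHol
  have h2 := ENNReal.rpow_le_rpow ((enorm_integral_le_lintegral_enorm h).trans hHol) hp0.le
  rw [ENNReal.mul_rpow_of_nonneg _ _ hp0.le, ← ENNReal.rpow_mul, ← ENNReal.rpow_mul,
    one_div_mul_cancel hp0.ne', ENNReal.rpow_one,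
    show 1 / (p / (p - 1)) * p = p - 1 by field_simp] at h2
  have h3 := h2.trans (mul_le_mul_right hw.moment.le _)
  have hI : 0 ≤ ∫ ω, lam ω * ‖h ω‖ ^ p ∂P := by
    refine integral_nonneg_of_ae ?_
    filter_upwards [hpos] with ω hω
    exact mul_nonneg hω.le (by positivity)
  rw [← ENNReal.ofReal_mul hI, ← ofReal_norm,
    ENNReal.ofReal_rpow_of_nonneg (norm_nonneg _) hp0.le,
    ENNReal.ofReal_le_ofReal_iff (mul_nonneg hI hw.pos.le)] at h3
  linarith

/-- Uniform coercivity of the mean energy over all potential fields. -/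
lemma IsDegenerateIntegrand.le_meanEnergy (hf : IsDegenerateIntegrand P p C lam f)
    (hw : IsAdmissibleWeight P p C lam) (hp : 1 < p) (hτ : IsDynamicalSystem P τ)
    {δ : ℝ} (hδ : 0 ≤ δ) (F : E d) {ψ : Lp (E d) (ENNReal.ofReal p) P}
    (hψ : ψ ∈ potSet P τ p lam) :
    C⁻¹ * ‖F‖ ^ p - C ≤ meanEnergy P p lam f δ (F, ψ) := by
  have hC := hw.pos
  have hχi := memLp_integrable hp hψ.1
  have hint : ∫ ω, (F + damp p lam ω • ψ ω) ∂P = F := by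
    rw [integral_add (integrable_const F) hχi, integral_eq_zero_of_mem_Lpot hp hτ hψ]
    simp
  have hlam := integrable_lam_mul_damp hw hp F ψ
  have h1 := norm_integral_rpow_le hw hp
    (aestronglyMeasurable_const.add (aestronglyMeasurable_damp_smul hw ψ)) hlam
  simp only [Pi.add_apply] at h1
  rw [hint] at h1
  have h2 : ∫ ω, (lam ω * ‖F + damp p lam ω • ψ ω‖ ^ p - C) ∂P ≤
      meanEnergy P p lam f δ (F, ψ) := by
    refine integral_mono_ae (hlam.sub (integrable_const C))
      (hf.integrable_meanEnergy hw hp δ (F, ψ)) ?_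
    filter_upwards [hf.growth] with ω h3
    exact (h3 _).1.trans (le_add_of_nonneg_right (by positivity))
  rw [integral_sub hlam (integrable_const C)] at h2
  simp only [integral_const, probReal_univ, one_smul] at h2
  have h3 : C⁻¹ * ‖F‖ ^ p ≤ ∫ ω, lam ω * ‖F + damp p lam ω • ψ ω‖ ^ p ∂P := by
    rw [inv_mul_le_iff₀ hC]
    exact h1
  linarith

/-- The homogenized value as a real number. No information is lost for a degenerate integrand, whose
homogenized value is finite (`coe_homReal`). -/
noncomputable def homReal (P : Measure Ω) (τ : E d → Ω → Ω) (p : ℝ) (f : Ω → E d → ℝ) (δ : ℝ)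
    (F : E d) : ℝ := (homValue P τ p f δ F).toReal

lemma coe_ciInf_eq {ι : Type*} [Nonempty ι] {a : ι → ℝ} (h : BddBelow (range a)) :
    ((⨅ i, a i : ℝ) : EReal) = ⨅ i, (a i : EReal) := by
  refine le_antisymm (le_iInf fun i => EReal.coe_le_coe_iff.2 (ciInf_le h i)) ?_
  refine EReal.le_of_forall_lt_iff_le.1 fun z hz => ?_
  obtain ⟨i, hi⟩ := exists_lt_of_ciInf_lt (EReal.coe_lt_coe_iff.1 hz)
  exact (iInf_le _ i).trans (EReal.coe_le_coe_iff.2 hi.le)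

lemma IsDegenerateIntegrand.bddBelow (hf : IsDegenerateIntegrand P p C lam f)
    (hw : IsAdmissibleWeight P p C lam) (hp : 1 < p) (hτ : IsDynamicalSystem P τ)
    {δ : ℝ} (hδ : 0 ≤ δ) (F : E d) :
    BddBelow (range fun ψ : potSet P τ p lam => meanEnergy P p lam f δ (F, ψ)) :=
  ⟨C⁻¹ * ‖F‖ ^ p - C, by rintro _ ⟨ψ, rfl⟩; exact hf.le_meanEnergy hw hp hτ hδ F ψ.2⟩

lemma IsDegenerateIntegrand.homValue_eq_coe_ciInf (hf : IsDegenerateIntegrand P p C lam f)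
    (hw : IsAdmissibleWeight P p C lam) (hp : 1 < p) (hτ : IsDynamicalSystem P τ)
    {δ : ℝ} (hδ : 0 ≤ δ) (F : E d) :
    homValue P τ p f δ F =
      ((⨅ ψ : potSet P τ p lam, meanEnergy P p lam f δ (F, ψ) : ℝ) : EReal) := by
  rw [homValue_eq_iInf_meanEnergy hf hw hp hδ, coe_ciInf_eq (hf.bddBelow hw hp hτ hδ F)]

lemma IsDegenerateIntegrand.homReal_eq_ciInf (hf : IsDegenerateIntegrand P p C lam f)
    (hw : IsAdmissibleWeight P p C lam) (hp : 1 < p) (hτ : IsDynamicalSystem P τ)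
    {δ : ℝ} (hδ : 0 ≤ δ) (F : E d) :
    homReal P τ p f δ F = ⨅ ψ : potSet P τ p lam, meanEnergy P p lam f δ (F, ψ) := by
  rw [homReal, hf.homValue_eq_coe_ciInf hw hp hτ hδ, EReal.toReal_coe]

lemma IsDegenerateIntegrand.coe_homReal (hf : IsDegenerateIntegrand P p C lam f)
    (hw : IsAdmissibleWeight P p C lam) (hp : 1 < p) (hτ : IsDynamicalSystem P τ)
    {δ : ℝ} (hδ : 0 ≤ δ) (F : E d) :
    ((homReal P τ p f δ F : ℝ) : EReal) = homValue P τ p f δ F := by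
  rw [hf.homReal_eq_ciInf hw hp hτ hδ, hf.homValue_eq_coe_ciInf hw hp hτ hδ]

lemma IsDegenerateIntegrand.le_homReal (hf : IsDegenerateIntegrand P p C lam f)
    (hw : IsAdmissibleWeight P p C lam) (hp : 1 < p) (hτ : IsDynamicalSystem P τ)
    {δ : ℝ} (hδ : 0 ≤ δ) (F : E d) : C⁻¹ * ‖F‖ ^ p - C ≤ homReal P τ p f δ F := by
  rw [hf.homReal_eq_ciInf hw hp hτ hδ]
  exact le_ciInf fun ψ => hf.le_meanEnergy hw hp hτ hδ F ψ.2

variable [Fact (1 ≤ ENNReal.ofReal p)]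

lemma IsDegenerateIntegrand.homReal_le (hf : IsDegenerateIntegrand P p C lam f)
    (hw : IsAdmissibleWeight P p C lam) (hp : 1 < p) (hτ : IsDynamicalSystem P τ)
    {δ : ℝ} (hδ : 0 ≤ δ) (F : E d) :
    homReal P τ p f δ F ≤ C * (2 ^ p * ((∫ ω, lam ω ∂P) * ‖F‖ ^ p) + 1) := by
  rw [hf.homReal_eq_ciInf hw hp hτ hδ]
  refine (ciInf_le (hf.bddBelow hw hp hτ hδ F)
    (⟨0, zero_mem_potSet⟩ : potSet P τ p lam)).trans ?_
  refine (hf.meanEnergy_le hw hp hδ _).trans (le_of_eq ?_)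
  simp [Real.zero_rpow (by linarith : p ≠ 0)]

lemma IsDegenerateIntegrand.convexOn_homReal (hf : IsDegenerateIntegrand P p C lam f)
    (hw : IsAdmissibleWeight P p C lam) (hp : 1 < p) (hτ : IsDynamicalSystem P τ)
    {δ : ℝ} (hδ : 0 ≤ δ) : ConvexOn ℝ univ (homReal P τ p f δ) := by
  refine ⟨convex_univ, fun F _ F' _ a b ha hb hab => ?_⟩
  simp only [hf.homReal_eq_ciInf hw hp hτ hδ, smul_eq_mul]
  refine le_of_forall_pos_lt_add fun ε hε => ?_
  obtain ⟨ψ, hψ⟩ := exists_lt_of_ciInf_lt (lt_add_of_pos_right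
    (⨅ ψ : potSet P τ p lam, meanEnergy P p lam f δ (F, ψ)) hε)
  obtain ⟨ψ', hψ'⟩ := exists_lt_of_ciInf_lt (lt_add_of_pos_right
    (⨅ ψ : potSet P τ p lam, meanEnergy P p lam f δ (F', ψ)) hε)
  refine (ciInf_le (hf.bddBelow hw hp hτ hδ _) (⟨a • ψ.1 + b • ψ'.1,
    combo_mem_potSet hp hτ ψ.2 ψ'.2 a b⟩ : potSet P τ p lam)).trans_lt ?_
  have h := (hf.convexOn_meanEnergy hw hp hδ).2 (mem_univ (F, ψ.1)) (mem_univ (F', ψ'.1)) ha hb hab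
  refine lt_of_le_of_lt h ?_
  simp only [smul_eq_mul]
  -- The strict inequality for `ψ` is only usable with a positive coefficient.
  rcases ha.eq_or_lt with rfl | ha'
  · have : b = 1 := by linarith
    subst this
    linarith
  · nlinarith [mul_lt_mul_of_pos_left hψ ha', mul_le_mul_of_nonneg_left hψ'.le hb]

/-- By separability of `L^p(Ω)` and continuity of the mean energy, the infimum may be taken over a
countable family of potential fields which does not depend on the integrand. -/
lemma IsDegenerateIntegrand.homReal_eq_ciInf_denseSeq [IsSeparable P]
    [Fact (ENNReal.ofReal p ≠ ⊤)] (hf : IsDegenerateIntegrand P p C lam f)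
    (hw : IsAdmissibleWeight P p C lam) (hp : 1 < p) (hτ : IsDynamicalSystem P τ)
    {δ : ℝ} (hδ : 0 ≤ δ) (F : E d) :
    homReal P τ p f δ F =
      ⨅ n, meanEnergy P p lam f δ (F, (TopologicalSpace.denseSeq (potSet P τ p lam) n).1) := by
  rw [hf.homReal_eq_ciInf hw hp hτ hδ]
  have hbdd := hf.bddBelow hw hp hτ hδ F
  have hbdd' : BddBelow (range fun n => meanEnergy P p lam f δ
      (F, (TopologicalSpace.denseSeq (potSet P τ p lam) n).1)) :=
    hbdd.mono (by rintro _ ⟨n, rfl⟩; exact ⟨_, rfl⟩)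
  refine le_antisymm (le_ciInf fun n => ciInf_le hbdd _) (le_ciInf fun ψ => ?_)
  have hcont : Continuous fun ψ : potSet P τ p lam => meanEnergy P p lam f δ (F, ψ.1) :=
    (hf.continuous_meanEnergy hw hp hδ).comp (by fun_prop)
  refine le_of_forall_pos_lt_add fun ε hε => ?_
  obtain ⟨n, hn⟩ :=
    (TopologicalSpace.denseRange_denseSeq (potSet P τ p lam)).exists_mem_open
      (isOpen_Iio.preimage hcont) ⟨ψ, show _ < _ from lt_add_of_pos_right _ hε⟩
  exact (ciInf_le hbdd' n).trans_lt hn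

end HomValue

/-! ### Dependence on the space variable and the integral functional -/

section Field

variable {Ω : Type*} [MeasurableSpace Ω] {P : Measure Ω} {d : ℕ} {τ : E d → Ω → Ω} {p C : ℝ}
  {lam : Ω → ℝ} {Q : Set (E d)} {V : Ω → E d → E d → ℝ}

/-- The hypotheses on `V` in terms of ordinary almost everywhere measurability: a typical section
`V(·,x,·)` is a degenerate integrand, and `V` is a Carathéodory integrand on `Ω × Q`. -/
structure IsDegenerateField (P : Measure Ω) (p C : ℝ) (lam : Ω → ℝ) (Q : Set (E d))
    (V : Ω → E d → E d → ℝ) : Prop where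
  weight : IsAdmissibleWeight P p C lam
  section_ae : ∀ᵐ x ∂(volume.restrict Q), IsDegenerateIntegrand P p C lam (fun ω => V ω x)
  aemeasurable : ∀ F, AEMeasurable (fun z : Ω × E d => V z.1 z.2 F) (P.prod (volume.restrict Q))
  convex : ∀ᵐ z ∂(P.prod (volume.restrict Q)), ConvexOn ℝ univ (V z.1 z.2)

/-- Sets that are measurable for the product with a completed factor are null measurable for the
product measure. -/
lemma prod_eventuallyMeasurableSpace_le {X : Type*} [mX : MeasurableSpace X] {ν : Measure X}
    {Ω : Type*} [mΩ : MeasurableSpace Ω] {P : Measure Ω} [SFinite ν] :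
    @Prod.instMeasurableSpace Ω X mΩ (eventuallyMeasurableSpace mX (ae ν)) ≤
      eventuallyMeasurableSpace (mΩ.prod mX) (ae (P.prod ν)) := by
  refine sup_le ?_ ?_
  · rintro _ ⟨A, hA, rfl⟩
    exact (measurable_fst hA).eventuallyMeasurableSet
  · rintro _ ⟨B, hB, rfl⟩
    have hB' : NullMeasurableSet B ν := hB
    exact hB'.preimage Measure.quasiMeasurePreserving_snd

/-- The integrand on `Ω × Q` factors through a function on `Ω × ℝ^d` that is measurable for
`𝓕 ⊗ 𝓛(ℝ^d)`. -/
lemma aemeasurable_of_integrandMeasurable [SFinite P] (hQ : MeasurableSet Q)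
    (hV : IntegrandMeasurable Q V) (F : E d) :
    AEMeasurable (fun z : Ω × E d => V z.1 z.2 F) (P.prod (volume.restrict Q)) := by
  rename_i mΩ _
  have hle : ∀ g : Ω × E d → ℝ, @Measurable _ _ (@Prod.instMeasurableSpace Ω (E d) mΩ
      (eventuallyMeasurableSpace inferInstance (ae (volume : Measure (E d))))) _ g →
      AEMeasurable g (P.prod (volume.restrict Q)) := by
    intro g hg
    have hgn : NullMeasurable g (P.prod (volume : Measure (E d))) :=
      fun s hs => prod_eventuallyMeasurableSpace_le (P := P) _ (hg hs)
    exact hgn.aemeasurable.mono_ac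
      (Measure.AbsolutelyContinuous.rfl.prod Measure.restrict_le_self.absolutelyContinuous)
  have hQae : ∀ᵐ z ∂(P.prod (volume.restrict Q)), z.2 ∈ Q :=
    Measure.quasiMeasurePreserving_snd.ae (ae_restrict_mem hQ)
  -- The completed `σ`-algebra becomes a second `MeasurableSpace` instance on `E d`, so every fact
  -- about `volume` is established before it is named.
  generalize hL : eventuallyMeasurableSpace _ (ae (volume : Measure (E d))) = L at hle
  let T : Ω × Q → Ω × E d := fun z => (z.1, z.2)
  have hcomap : @Prod.instMeasurableSpace Ω Q mΩ (lebesgueSigma Q) =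
      (@Prod.instMeasurableSpace Ω (E d) mΩ L).comap T := by
    simp only [Prod.instMeasurableSpace, MeasurableSpace.prod, MeasurableSpace.comap_sup,
      MeasurableSpace.comap_comp, lebesgueSigma, ← hL]
    rfl
  have hm := hV F
  rw [hcomap] at hm
  obtain ⟨g, hg, hVg⟩ : ∃ g : Ω × E d → ℝ,
      @Measurable _ _ (@Prod.instMeasurableSpace Ω (E d) mΩ L) _ g ∧
        (fun z : Ω × Q => V z.1 z.2 F) = g ∘ T :=
    Measurable.exists_eq_measurable_comp (mY := @Prod.instMeasurableSpace Ω (E d) mΩ L) hm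
  refine (hle g hg).congr ?_
  filter_upwards [hQae] with z hz
  exact (congrFun hVg (z.1, ⟨z.2, hz⟩)).symm

lemma measurable_section_of_integrandMeasurable (hV : IntegrandMeasurable Q V) {x : E d}
    (hx : x ∈ Q) (F : E d) : Measurable fun ω => V ω x F := by
  rename_i mΩ
  exact (hV F).comp (@measurable_prodMk_right Ω Q mΩ (lebesgueSigma Q) ⟨x, hx⟩)

lemma ae_ae_swap [SFinite P] {q : Ω × E d → Prop}
    (h : ∀ᵐ z ∂(P.prod (volume.restrict Q)), q z) :
    ∀ᵐ x ∂(volume.restrict Q), ∀ᵐ ω ∂P, q (ω, x) := by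
  have h' : ∀ᵐ z ∂((volume.restrict Q).prod P), q z.swap :=
    (Measure.measurePreserving_swap).quasiMeasurePreserving.ae h
  exact Measure.ae_ae_of_ae_prod h'

lemma exists_isDegenerateField [SFinite P] (hQ : MeasurableSet Q)
    (hV1 : IntegrandMeasurable Q V) (hV2 : IntegrandConvex P Q V)
    (hV3 : DegenerateGrowth P p Q V) : ∃ C lam, IsDegenerateField P p C lam Q V := by
  obtain ⟨C, lam, hC, hlam, hmom, hgr⟩ := hV3
  refine ⟨C, lam, ⟨hC, hlam, hmom⟩, ?_, aemeasurable_of_integrandMeasurable hQ hV1, hV2⟩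
  filter_upwards [ae_ae_swap hV2, ae_ae_swap hgr, ae_restrict_mem hQ] with x h1 h2 hx
  exact ⟨fun F => (measurable_section_of_integrandMeasurable hV1 hx F).aemeasurable, h1, h2⟩

variable [IsProbabilityMeasure P] [Fact (1 ≤ ENNReal.ofReal p)] [Fact (ENNReal.ofReal p ≠ ⊤)]

lemma IsDegenerateField.aestronglyMeasurable_meanEnergy (hV : IsDegenerateField P p C lam Q V)
    (δ : ℝ) {G : E d → E d} (hG : AEStronglyMeasurable G (volume.restrict Q))
    (ψ : Lp (E d) (ENNReal.ofReal p) P) :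
    AEStronglyMeasurable (fun x => meanEnergy P p lam (fun ω => V ω x) δ (G x, ψ))
      (volume.restrict Q) := by
  have hψ := (aestronglyMeasurable_damp_smul hV.weight ψ).comp_fst (ν := volume.restrict Q)
  have hΦ : AEStronglyMeasurable (fun z : Ω × E d => G z.2 + damp p lam z.1 • ψ z.1)
      (P.prod (volume.restrict Q)) := hG.comp_snd.add hψ
  have h1 : AEMeasurable (fun z : Ω × E d => V z.1 z.2 (G z.2 + damp p lam z.1 • ψ z.1))
      (P.prod (volume.restrict Q)) :=
    aemeasurable_comp_of_continuous hV.aemeasurable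
      (hV.convex.mono fun _ h => continuous_of_convexOn_univ h) hΦ
  have h2 : AEMeasurable (fun z : Ω × E d => V z.1 z.2 (G z.2 + damp p lam z.1 • ψ z.1) +
      δ * ‖damp p lam z.1 • ψ z.1‖ ^ p) (P.prod (volume.restrict Q)) :=
    h1.add ((hψ.norm.aemeasurable.pow_const p).const_mul δ)
  exact h2.aestronglyMeasurable.prod_swap.integral_prod_right'

variable [IsSeparable P]

lemma IsDegenerateField.aemeasurable_homReal (hV : IsDegenerateField P p C lam Q V)
    (hp : 1 < p) (hτ : IsDynamicalSystem P τ) {δ : ℝ} (hδ : 0 ≤ δ) {G : E d → E d}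
    (hG : AEStronglyMeasurable G (volume.restrict Q)) :
    AEMeasurable (fun x => homReal P τ p (fun ω => V ω x) δ (G x)) (volume.restrict Q) := by
  have h : AEMeasurable (fun x => ⨅ n, meanEnergy P p lam (fun ω => V ω x) δ
      (G x, (TopologicalSpace.denseSeq (potSet P τ p lam) n).1)) (volume.restrict Q) :=
    AEMeasurable.iInf fun n => (hV.aestronglyMeasurable_meanEnergy δ hG _).aemeasurable
  refine h.congr ?_
  filter_upwards [hV.section_ae] with x hx
  exact (hx.homReal_eq_ciInf_denseSeq hV.weight hp hτ hδ (G x)).symm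

/-- The effective energy density is of `p`-growth from above and bounded below. -/
lemma IsDegenerateField.abs_homReal_le (hV : IsDegenerateField P p C lam Q V)
    (hp : 1 < p) (hτ : IsDynamicalSystem P τ) :
    ∀ᵐ x ∂(volume.restrict Q), ∀ F : E d, ∀ δ : ℝ, 0 ≤ δ →
      |homReal P τ p (fun ω => V ω x) δ F| ≤ C * (2 ^ p * ((∫ ω, lam ω ∂P) * ‖F‖ ^ p) + 1) := by
  have hC := hV.weight.pos
  have hl : 0 ≤ ∫ ω, lam ω ∂P :=
    integral_nonneg_of_ae ((hV.weight.ae_pos hp).mono fun _ h => h.le)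
  filter_upwards [hV.section_ae] with x hx F δ hδ
  refine abs_le.2 ⟨?_, hx.homReal_le hV.weight hp hτ hδ F⟩
  have h1 := hx.le_homReal hV.weight hp hτ hδ F
  have h2 : 0 ≤ C⁻¹ * ‖F‖ ^ p := by positivity
  have h3 : 0 ≤ C * (2 ^ p * ((∫ ω, lam ω ∂P) * ‖F‖ ^ p)) := by positivity
  linarith

variable [IsFiniteMeasure (volume.restrict Q)]

lemma integrable_growth_bound (hp : 1 < p) (a b : ℝ) {G : E d → E d}
    (hG : MemLp G (ENNReal.ofReal p) (volume.restrict Q)) :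
    Integrable (fun x => C * (a * (b * ‖G x‖ ^ p) + 1)) (volume.restrict Q) := by
  have hGp := hG.integrable_norm_rpow (by simpa using zero_lt_one.trans hp) ENNReal.ofReal_ne_top
  rw [ENNReal.toReal_ofReal (by linarith)] at hGp
  exact (((hGp.const_mul _).const_mul _).add (integrable_const 1)).const_mul C

lemma IsDegenerateField.integrable_homReal (hV : IsDegenerateField P p C lam Q V)
    (hp : 1 < p) (hτ : IsDynamicalSystem P τ) {δ : ℝ} (hδ : 0 ≤ δ) {G : E d → E d}
    (hG : MemLp G (ENNReal.ofReal p) (volume.restrict Q)) :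
    Integrable (fun x => homReal P τ p (fun ω => V ω x) δ (G x)) (volume.restrict Q) := by
  refine (integrable_growth_bound (C := C) hp (2 ^ p) (∫ ω, lam ω ∂P) hG).mono'
    (hV.aemeasurable_homReal hp hτ hδ hG.1).aestronglyMeasurable ?_
  filter_upwards [hV.abs_homReal_le hp hτ] with x hx using hx _ _ hδ

/-- The integral functional `g ↦ ∫_Q V_{hom,δ}(x,g(x)) dx`. -/
noncomputable def homFunctional (P : Measure Ω) (τ : E d → Ω → Ω) (p : ℝ) (Q : Set (E d))
    (V : Ω → E d → E d → ℝ) (δ : ℝ) (G : E d → E d) : ℝ :=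
  ∫ x in Q, homReal P τ p (fun ω => V ω x) δ (G x)

lemma IsDegenerateField.extIntegral_vhomReg (hV : IsDegenerateField P p C lam Q V)
    (hp : 1 < p) (hτ : IsDynamicalSystem P τ) {δ : ℝ} (hδ : 0 ≤ δ) {G : E d → E d}
    (hG : MemLp G (ENNReal.ofReal p) (volume.restrict Q)) :
    extIntegral (volume.restrict Q) (fun x => VhomReg P τ p V δ x (G x)) =
      (homFunctional P τ p Q V δ G : EReal) := by
  rw [homFunctional, ← extIntegral_coe (hV.integrable_homReal hp hτ hδ hG)]
  refine extIntegral_congr_ae ?_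
  filter_upwards [hV.section_ae] with x hx
  exact (hx.coe_homReal hV.weight hp hτ hδ (G x)).symm

lemma IsDegenerateField.tendsto_homFunctional (hV : IsDegenerateField P p C lam Q V)
    (hp : 1 < p) (hτ : IsDynamicalSystem P τ) {G : E d → E d}
    (hG : MemLp G (ENNReal.ofReal p) (volume.restrict Q)) :
    Tendsto (fun δ => homFunctional P τ p Q V δ G) (𝓝[>] 0) (𝓝 (homFunctional P τ p Q V 0 G)) := by
  refine tendsto_integral_filter_of_dominated_convergence
    (fun x => C * (2 ^ p * ((∫ ω, lam ω ∂P) * ‖G x‖ ^ p) + 1)) ?_ ?_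
    (integrable_growth_bound hp _ _ hG) ?_
  · filter_upwards [self_mem_nhdsWithin] with δ hδ
    exact (hV.aemeasurable_homReal hp hτ (le_of_lt hδ) hG.1).aestronglyMeasurable
  · filter_upwards [self_mem_nhdsWithin] with δ hδ
    filter_upwards [hV.abs_homReal_le hp hτ] with x hx using hx _ _ (le_of_lt hδ)
  · filter_upwards [hV.section_ae] with x hx
    have h := tendsto_vhomReg (P := P) (τ := τ) (V := V) hp x (G x)
    rw [← vhomReg_zero] at h
    have h0 := hx.coe_homReal hV.weight hp hτ le_rfl (G x)
    refine (EReal.tendsto_toReal ?_ ?_).comp h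
    · exact fun h => EReal.coe_ne_top _ (h0.trans h)
    · exact fun h => EReal.coe_ne_bot _ (h0.trans h)

lemma IsDegenerateField.le_homFunctional (hV : IsDegenerateField P p C lam Q V)
    (hp : 1 < p) (hτ : IsDynamicalSystem P τ) {δ : ℝ} (hδ : 0 ≤ δ)
    (g : Lp (E d) (ENNReal.ofReal p) (volume.restrict Q)) :
    C⁻¹ * ‖g‖ ^ p - C * (volume.restrict Q).real univ ≤ homFunctional P τ p Q V δ g := by
  have hgp := Lp_integrable_norm_rpow hp g
  have h : ∫ x in Q, (C⁻¹ * ‖g x‖ ^ p - C) ≤ homFunctional P τ p Q V δ g := by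
    refine integral_mono_ae ((hgp.const_mul _).sub (integrable_const C))
      (hV.integrable_homReal hp hτ hδ (Lp.memLp g)) ?_
    filter_upwards [hV.section_ae] with x hx
    exact hx.le_homReal hV.weight hp hτ hδ _
  rw [integral_sub (hgp.const_mul _) (integrable_const C), integral_const_mul,
    ← Lp_norm_rpow_eq hp, integral_const, smul_eq_mul] at h
  linarith

lemma IsDegenerateField.convexOn_homFunctional (hV : IsDegenerateField P p C lam Q V)
    (hp : 1 < p) (hτ : IsDynamicalSystem P τ) {δ : ℝ} (hδ : 0 ≤ δ) :
    ConvexOn ℝ univ (fun g : Lp (E d) (ENNReal.ofReal p) (volume.restrict Q) =>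
      homFunctional P τ p Q V δ g) := by
  refine ⟨convex_univ, fun g _ g' _ a b ha hb hab => ?_⟩
  have hi := hV.integrable_homReal hp hτ hδ (Lp.memLp g)
  have hi' := hV.integrable_homReal hp hτ hδ (Lp.memLp g')
  simp only [smul_eq_mul]
  unfold homFunctional
  rw [← integral_const_mul, ← integral_const_mul, ← integral_add (hi.const_mul a) (hi'.const_mul b)]
  refine integral_mono_ae (hV.integrable_homReal hp hτ hδ (Lp.memLp _))
    ((hi.const_mul a).add (hi'.const_mul b)) ?_
  filter_upwards [hV.section_ae, Lp.coeFn_add (a • g) (b • g'), Lp.coeFn_smul a g,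
    Lp.coeFn_smul b g'] with x hx h1 h2 h3
  rw [h1, Pi.add_apply, h2, h3]
  exact (hx.convexOn_homReal hV.weight hp hτ hδ).2 (mem_univ _) (mem_univ _) ha hb hab

lemma IsDegenerateField.continuous_homFunctional (hV : IsDegenerateField P p C lam Q V)
    (hp : 1 < p) (hτ : IsDynamicalSystem P τ) {δ : ℝ} (hδ : 0 ≤ δ) :
    Continuous (fun g : Lp (E d) (ENNReal.ofReal p) (volume.restrict Q) =>
      homFunctional P τ p Q V δ g) := by
  have hC := hV.weight.pos
  set Λ := ∫ ω, lam ω ∂P with hΛ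
  have hl : 0 ≤ Λ := integral_nonneg_of_ae ((hV.weight.ae_pos hp).mono fun _ h => h.le)
  refine ConvexOn.continuous_of_bddAbove_ball (hV.convexOn_homFunctional hp hτ hδ)
    (M := C * (2 ^ p * (Λ * 1) + (volume.restrict Q).real univ)) fun g hg => ?_
  have hgp := Lp_integrable_norm_rpow hp g
  have h : homFunctional P τ p Q V δ g ≤ ∫ x in Q, C * (2 ^ p * (Λ * ‖g x‖ ^ p) + 1) := by
    refine integral_mono_ae (hV.integrable_homReal hp hτ hδ (Lp.memLp g))
      (integrable_growth_bound hp _ _ (Lp.memLp g)) ?_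
    filter_upwards [hV.section_ae] with x hx
    exact hx.homReal_le hV.weight hp hτ hδ _
  have i1 : Integrable (fun x => 2 ^ p * (Λ * ‖g x‖ ^ p)) (volume.restrict Q) :=
    (hgp.const_mul _).const_mul _
  rw [integral_const_mul, integral_add i1 (integrable_const 1),
    integral_const_mul, integral_const_mul, ← Lp_norm_rpow_eq hp, integral_const, smul_eq_mul,
    mul_one] at h
  have h1 : ‖g‖ ^ p ≤ 1 := Real.rpow_le_one (norm_nonneg _) hg (by linarith)
  refine h.trans ?_
  gcongr

end Field

/-! ### Test functions -/

section TestFunctions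

variable {d : ℕ} {Q : Set (E d)} {η η' : E d → ℝ}

lemma IsTestFun.differentiable (h : IsTestFun Q η) : Differentiable ℝ η :=
  h.1.differentiable (by simp)

lemma IsTestFun.continuous (h : IsTestFun Q η) : Continuous η := h.1.continuous

lemma gradient_eq_comp (η : E d → ℝ) :
    gradient η = (InnerProductSpace.toDual ℝ (E d)).symm ∘ fderiv ℝ η := rfl

lemma IsTestFun.continuous_gradient (h : IsTestFun Q η) : Continuous (gradient η) := by
  rw [gradient_eq_comp]
  exact (LinearIsometryEquiv.continuous _).comp (h.1.continuous_fderiv (by simp))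

lemma IsTestFun.hasCompactSupport_gradient (h : IsTestFun Q η) :
    HasCompactSupport (gradient η) := by
  rw [gradient_eq_comp]
  exact (h.2.1.fderiv ℝ).comp_left (map_zero _)

lemma norm_gradient (η : E d → ℝ) (x : E d) : ‖gradient η x‖ = ‖fderiv ℝ η x‖ := by
  simp [gradient]

lemma tsupport_gradient_subset (η : E d → ℝ) : tsupport (gradient η) ⊆ tsupport η := by
  refine (closure_mono fun x hx => ?_).trans (closure_minimal (support_fderiv_subset ℝ)
    (isClosed_tsupport η))
  rw [Function.mem_support] at hx ⊢
  rwa [← norm_ne_zero_iff, norm_gradient, norm_ne_zero_iff] at hx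

lemma IsTestFun.support_subset (h : IsTestFun Q η) : Function.support η ⊆ Q :=
  (subset_tsupport η).trans h.2.2

lemma IsTestFun.support_gradient_subset (h : IsTestFun Q η) :
    Function.support (gradient η) ⊆ Q :=
  (subset_tsupport _).trans ((tsupport_gradient_subset η).trans h.2.2)

lemma IsTestFun.memLp (h : IsTestFun Q η) (q : ℝ≥0∞) : MemLp η q (volume.restrict Q) :=
  (h.continuous.memLp_of_hasCompactSupport h.2.1).restrict Q

lemma IsTestFun.memLp_gradient (h : IsTestFun Q η) (q : ℝ≥0∞) :
    MemLp (gradient η) q (volume.restrict Q) :=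
  (h.continuous_gradient.memLp_of_hasCompactSupport h.hasCompactSupport_gradient).restrict Q

lemma IsTestFun.combo (h : IsTestFun Q η) (h' : IsTestFun Q η') (a b : ℝ) :
    IsTestFun Q (fun x => a * η x + b * η' x) := by
  refine ⟨(contDiff_const.mul h.1).add (contDiff_const.mul h'.1),
    (h.2.1.mul_left (f := fun _ => a)).add (h'.2.1.mul_left (f := fun _ => b)), ?_⟩
  refine (tsupport_add (fun x => a * η x) (fun x => b * η' x)).trans (union_subset ?_ ?_)
  · exact (tsupport_mul_subset_right (f := fun _ => a)).trans h.2.2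
  · exact (tsupport_mul_subset_right (f := fun _ => b)).trans h'.2.2

lemma IsTestFun.gradient_combo (h : IsTestFun Q η) (h' : IsTestFun Q η') (a b : ℝ) (x : E d) :
    gradient (fun x => a * η x + b * η' x) x = a • gradient η x + b • gradient η' x := by
  have h1 := h.differentiable x
  have h2 := h'.differentiable x
  simp only [gradient]
  rw [fderiv_fun_add (h1.const_mul a) (h2.const_mul b), fderiv_const_mul h1, fderiv_const_mul h2]
  simp

/-- Integration by parts for two test functions. -/
lemma IsTestFun.integral_smul_gradient (h : IsTestFun Q η) (h' : IsTestFun Q η') :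
    ∫ x in Q, η x • gradient η' x = -∫ x in Q, η' x • gradient η x := by
  have e1 : ∫ x in Q, η x • gradient η' x = ∫ x, η x • gradient η' x :=
    setIntegral_eq_integral_of_forall_compl_eq_zero fun x hx => by
      rw [Function.notMem_support.1 (fun h0 => hx (h.support_subset h0)), zero_smul]
  have e2 : ∫ x in Q, η' x • gradient η x = ∫ x, η' x • gradient η x :=
    setIntegral_eq_integral_of_forall_compl_eq_zero fun x hx => by
      rw [Function.notMem_support.1 (fun h0 => hx (h'.support_subset h0)), zero_smul]
  rw [e1, e2]
  have i1 : Integrable (fun x => η x • gradient η' x) :=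
    (h.continuous.smul h'.continuous_gradient).integrable_of_hasCompactSupport
      (h.2.1.smul_right (f' := gradient η'))
  have i2 : Integrable (fun x => η' x • gradient η x) :=
    (h'.continuous.smul h.continuous_gradient).integrable_of_hasCompactSupport
      (h'.2.1.smul_right (f' := gradient η))
  refine ext_inner_right ℝ fun v => ?_
  have i1v : Integrable (fun x => η x * fderiv ℝ η' x v) := by
    refine (i1.inner_const v).congr (.of_forall fun x => ?_)
    simp only [inner_smul_left, inner_gradient_left]
    simp
  have i2v : Integrable (fun x => η' x * fderiv ℝ η x v) := by
    refine (i2.inner_const v).congr (.of_forall fun x => ?_)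
    simp only [inner_smul_left, inner_gradient_left]
    simp
  have i3 : Integrable (fun x => η x * η' x) :=
    (h.continuous.mul h'.continuous).integrable_of_hasCompactSupport (h.2.1.mul_right)
  have key := integral_mul_fderiv_eq_neg_fderiv_mul_of_integrable (μ := volume) (v := v)
    (f := η) (g := η') (by simpa only [mul_comm] using i2v) i1v i3
    (fun x _ => h.differentiable x) (fun x _ => h'.differentiable x)
  rw [inner_neg_left, real_inner_comm, real_inner_comm v, ← integral_inner i1, ← integral_inner i2]
  simp only [inner_smul_right, inner_gradient_right]
  simpa [mul_comm] using key

end TestFunctions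

/-! ### Poincaré's inequality -/

section Poincare

variable {d : ℕ} {Q : Set (E d)} {p : ℝ}

/-- Jensen's inequality on an interval of length `R`. -/
lemma lintegral_Ioc_rpow_le (hp : 1 < p) (R : ℝ) {g : ℝ → ℝ≥0∞} (hg : AEMeasurable g) :
    (∫⁻ s in Ioc 0 R, g s) ^ p ≤ ENNReal.ofReal R ^ (p - 1) * ∫⁻ s in Ioc 0 R, g s ^ p := by
  have hp0 : 0 < p := by linarith
  have hpq : p.HolderConjugate (p / (p - 1)) := Real.HolderConjugate.conjExponent hp
  have h := ENNReal.lintegral_mul_le_Lp_mul_Lq (volume.restrict (Ioc 0 R)) hpq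
    (f := g) (g := fun _ => 1) hg.restrict aemeasurable_const
  have hp1 : p - 1 ≠ 0 := by linarith
  have h2 := ENNReal.rpow_le_rpow h hp0.le
  simp only [Pi.mul_apply, mul_one, ENNReal.one_rpow, lintegral_const, one_mul] at h2
  rw [ENNReal.mul_rpow_of_nonneg _ _ hp0.le, ← ENNReal.rpow_mul, ← ENNReal.rpow_mul,
    one_div_mul_cancel hp0.ne', ENNReal.rpow_one,
    show 1 / (p / (p - 1)) * p = p - 1 by field_simp, Measure.restrict_apply_univ,
    Real.volume_Ioc, sub_zero, mul_comm] at h2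
  exact h2

/-- The fundamental theorem of calculus along the segment from `x` in direction `-e`, which leaves
`Q` after length `R`. -/
lemma IsTestFun.enorm_le_lintegral {η : E d → ℝ} (h : IsTestFun Q η) {e : E d} (he : ‖e‖ ≤ 1)
    {R : ℝ} (hR : 0 < R) {x : E d} (hx : x - R • e ∉ Q) :
    ‖η x‖ₑ ≤ ∫⁻ s in Ioc 0 R, ‖gradient η (x - s • e)‖ₑ := by
  have hder : ∀ s : ℝ, HasDerivAt (fun s : ℝ => η (x - s • e))
      (fderiv ℝ η (x - s • e) (-e)) s := by
    intro s
    have h1 : HasDerivAt (fun s : ℝ => x - s • e) (-e) s := by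
      simpa using ((hasDerivAt_id s).smul_const e).const_sub x
    exact (h.differentiable _).hasFDerivAt.comp_hasDerivAt s h1
  have hcont : Continuous fun s : ℝ => fderiv ℝ η (x - s • e) (-e) :=
    ((h.1.continuous_fderiv (by simp)).comp (by fun_prop)).clm_apply continuous_const
  have hftc := intervalIntegral.integral_eq_sub_of_hasDerivAt (a := 0) (b := R)
    (fun s _ => hder s) (hcont.intervalIntegrable _ _)
  have h0 : η (x - R • e) = 0 :=
    Function.notMem_support.1 fun h0 => hx (h.support_subset h0)
  simp only [h0, zero_smul, sub_zero, zero_sub] at hftc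
  rw [intervalIntegral.integral_of_le hR.le] at hftc
  calc ‖η x‖ₑ = ‖∫ s in Ioc 0 R, fderiv ℝ η (x - s • e) (-e)‖ₑ := by rw [hftc, enorm_neg]
    _ ≤ ∫⁻ s in Ioc 0 R, ‖fderiv ℝ η (x - s • e) (-e)‖ₑ := enorm_integral_le_lintegral_enorm _
    _ ≤ _ := by
      refine lintegral_mono fun s => ?_
      refine enorm_le_iff_norm_le.2 ?_
      rw [norm_gradient]
      refine (ContinuousLinearMap.le_opNorm _ _).trans ?_
      rw [norm_neg]
      exact mul_le_of_le_one_right (norm_nonneg _) he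

/-- Poincaré's inequality for test functions on a bounded set, in positive dimension. -/
lemma IsTestFun.eLpNorm_le_gradient (hp : 1 < p) (hQ : MeasurableSet Q) {e : E d} (he : ‖e‖ = 1)
    {R : ℝ} (hR : 0 < R) (hRQ : ∀ x ∈ Q, x - R • e ∉ Q) {η : E d → ℝ} (h : IsTestFun Q η) :
    eLpNorm η (ENNReal.ofReal p) (volume.restrict Q) ≤
      ENNReal.ofReal R * eLpNorm (gradient η) (ENNReal.ofReal p) (volume.restrict Q) := by
  have hp0 : 0 < p := by linarith
  have hpne : ENNReal.ofReal p ≠ 0 := by simpa using hp0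
  have hgm : Measurable fun x => ‖gradient η x‖ₑ := h.continuous_gradient.enorm.measurable
  have hgm2 : Measurable fun z : E d × ℝ => ‖gradient η (z.1 - z.2 • e)‖ₑ :=
    hgm.comp (by fun_prop)
  have key : ∫⁻ x in Q, ‖η x‖ₑ ^ p ≤ ENNReal.ofReal R ^ p * ∫⁻ x in Q, ‖gradient η x‖ₑ ^ p := by
    have hsupp : ∫⁻ x in Q, ‖gradient η x‖ₑ ^ p = ∫⁻ x, ‖gradient η x‖ₑ ^ p := by
      rw [← lintegral_indicator hQ]
      congr 1
      funext x
      by_cases hx : x ∈ Q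
      · rw [indicator_of_mem hx]
      · rw [indicator_of_notMem hx,
          Function.notMem_support.1 (fun h0 => hx (h.support_gradient_subset h0))]
        simp [hp0]
    calc ∫⁻ x in Q, ‖η x‖ₑ ^ p
        ≤ ∫⁻ x in Q, ENNReal.ofReal R ^ (p - 1) *
            ∫⁻ s in Ioc 0 R, ‖gradient η (x - s • e)‖ₑ ^ p := by
          refine setLIntegral_mono' hQ fun x hx => ?_
          refine (ENNReal.rpow_le_rpow (h.enorm_le_lintegral he.le hR (hRQ x hx)) hp0.le).trans ?_
          exact lintegral_Ioc_rpow_le hp R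
            (hgm.comp (by fun_prop : Measurable fun s : ℝ => x - s • e)).aemeasurable
      _ ≤ ∫⁻ x, ENNReal.ofReal R ^ (p - 1) *
            ∫⁻ s in Ioc 0 R, ‖gradient η (x - s • e)‖ₑ ^ p := setLIntegral_le_lintegral _ _
      _ = ENNReal.ofReal R ^ (p - 1) *
            ∫⁻ x, ∫⁻ s in Ioc 0 R, ‖gradient η (x - s • e)‖ₑ ^ p := by
          rw [lintegral_const_mul' _ _ (by
            exact ENNReal.rpow_ne_top_of_nonneg (by linarith) ENNReal.ofReal_ne_top)]
      _ = ENNReal.ofReal R ^ (p - 1) *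
            ∫⁻ s in Ioc 0 R, ∫⁻ x, ‖gradient η (x - s • e)‖ₑ ^ p := by
          rw [lintegral_lintegral_swap (hgm2.pow_const p).aemeasurable]
      _ = ENNReal.ofReal R ^ (p - 1) * ∫⁻ _ in Ioc 0 R, ∫⁻ x, ‖gradient η x‖ₑ ^ p := by
          congr 1
          refine lintegral_congr fun s => ?_
          exact lintegral_sub_right_eq_self (fun x => ‖gradient η x‖ₑ ^ p) (s • e)
      _ = ENNReal.ofReal R ^ p * ∫⁻ x in Q, ‖gradient η x‖ₑ ^ p := by
          rw [hsupp, lintegral_const, Measure.restrict_apply_univ, Real.volume_Ioc, sub_zero,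
            mul_comm (∫⁻ x, _), ← mul_assoc]
          congr 1
          have hR0 : ENNReal.ofReal R ≠ 0 := by simpa using hR
          nth_rw 2 [← ENNReal.rpow_one (ENNReal.ofReal R)]
          rw [← ENNReal.rpow_add _ _ hR0 ENNReal.ofReal_ne_top]
          congr 1; ring
  rw [eLpNorm_eq_lintegral_rpow_enorm_toReal hpne ENNReal.ofReal_ne_top,
    eLpNorm_eq_lintegral_rpow_enorm_toReal hpne ENNReal.ofReal_ne_top, ENNReal.toReal_ofReal hp0.le]
  refine (ENNReal.rpow_le_rpow key (by positivity)).trans (le_of_eq ?_)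
  rw [ENNReal.mul_rpow_of_nonneg _ _ (by positivity), ← ENNReal.rpow_mul, mul_one_div_cancel hp0.ne',
    ENNReal.rpow_one]

/-- A Poincaré-type inequality for test functions. The lower order term is only needed in dimension
zero, where it replaces the gradient. -/
lemma exists_poincare (hp : 1 < p) (hQ : MeasurableSet Q) (hQb : Bornology.IsBounded Q) :
    ∃ K : ℝ≥0∞, K ≠ ⊤ ∧ ∀ η : E d → ℝ, IsTestFun Q η →
      eLpNorm η (ENNReal.ofReal p) (volume.restrict Q) ≤
        K * (eLpNorm (gradient η) (ENNReal.ofReal p) (volume.restrict Q) +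
          eLpNorm η 1 (volume.restrict Q)) := by
  rcases Nat.eq_zero_or_pos d with rfl | hd
  · have hfin : volume.restrict Q univ ≠ ⊤ := by
      rw [Measure.restrict_apply_univ]; exact hQb.measure_lt_top.ne
    by_cases h0 : volume.restrict Q = 0
    · exact ⟨0, ENNReal.zero_ne_top, fun η _ => by simp [h0]⟩
    have hu0 : volume.restrict Q univ ≠ 0 := by simpa using h0
    refine ⟨volume.restrict Q univ ^ (1 / p) / volume.restrict Q univ,
      ENNReal.div_ne_top (ENNReal.rpow_ne_top_of_nonneg (by positivity) hfin) hu0,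
      fun η _ => ?_⟩
    have hη : η = fun _ => η 0 := funext fun x => congrArg η (Subsingleton.elim x 0)
    have hpne : ENNReal.ofReal p ≠ 0 := by simpa using zero_lt_one.trans hp
    rw [hη, eLpNorm_const _ hpne h0, eLpNorm_const _ one_ne_zero h0,
      ENNReal.toReal_ofReal (by linarith)]
    refine le_trans (le_of_eq ?_) (mul_le_mul_right le_add_self _)
    simp only [ENNReal.toReal_one, div_one, ENNReal.rpow_one]
    rw [mul_comm ‖η 0‖ₑ (volume.restrict Q univ), ← mul_assoc, ENNReal.div_mul_cancel hu0 hfin,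
      mul_comm]
  · obtain ⟨r, hr⟩ := hQb.subset_ball 0
    set e : E d := EuclideanSpace.single ⟨0, hd⟩ 1 with he
    have hen : ‖e‖ = 1 := by simp [he]
    -- `R` exceeds the diameter of the ball, so translation by `R • e` moves `Q` off itself.
    set R : ℝ := 2 * |r| + 1 with hRdef
    have hR : 0 < R := by positivity
    refine ⟨ENNReal.ofReal R, ENNReal.ofReal_ne_top, fun η h => ?_⟩
    refine (h.eLpNorm_le_gradient hp hQ hen hR fun x hx hx' => ?_).trans
      (mul_le_mul_right le_self_add _)
    have h1 : ‖x‖ < r := by simpa using hr hx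
    have h2 : ‖x - R • e‖ < r := by simpa using hr hx'
    have h3 : ‖R • e‖ = R := by rw [norm_smul, hen, mul_one, Real.norm_of_nonneg hR.le]
    have h4 : ‖R • e‖ ≤ ‖x‖ + ‖x - R • e‖ := by
      have := norm_sub_le x (x - R • e)
      simpa using this
    rw [h3] at h4
    linarith [le_abs_self r]

end Poincare

/-! ### Continuity of integral pairings -/

section Pairing

/-- Integration of `L^q` functions against a bounded operator-valued weight is continuous on a
finite measure space. -/
lemma continuous_integral_clm {α X Y : Type*} [MeasurableSpace α] {μ : Measure α}
    [IsFiniteMeasure μ] [NormedAddCommGroup X] [NormedSpace ℝ X] [NormedAddCommGroup Y]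
    [NormedSpace ℝ Y] {q : ℝ≥0∞} [hq : Fact (1 ≤ q)] {T : α → X →L[ℝ] Y}
    (hT : AEStronglyMeasurable T μ) {M : ℝ} (hM : ∀ a, ‖T a‖ ≤ M) :
    Continuous fun g : Lp X q μ => ∫ a, T a (g a) ∂μ := by
  have hint : ∀ g : Lp X q μ, Integrable (fun a => T a (g a)) μ := fun g => by
    have hg : Integrable g μ := (Lp.memLp g).integrable hq.out
    refine Integrable.mono' (hg.norm.const_mul M)
      (isBoundedBilinearMap_apply.continuous.comp_aestronglyMeasurable₂ hT hg.1)
      (.of_forall fun a => ?_)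
    exact (ContinuousLinearMap.le_opNorm _ _).trans
      (mul_le_mul_of_nonneg_right (hM a) (norm_nonneg _))
  -- The norm of the embedding of `L^q` into `L^1`.
  set c : ℝ≥0∞ := μ univ ^ (1 / (1 : ℝ≥0∞).toReal - 1 / q.toReal) with hc
  have hctop : c ≠ ⊤ := by
    rcases eq_or_ne (μ univ) 0 with h0 | h0
    · refine ENNReal.rpow_ne_top_of_nonneg ?_ (by simp [h0])
      rcases eq_or_ne q ⊤ with rfl | hqt
      · simp
      have h1 : 1 ≤ q.toReal := by
        simpa using ENNReal.toReal_mono hqt hq.out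
      have : 1 / q.toReal ≤ 1 := by rw [div_le_one (by linarith)]; exact h1
      simpa using this
    · exact ENNReal.rpow_ne_top_of_ne_zero h0 (measure_ne_top _ _)
  have hMn : 0 ≤ max M 0 := le_max_right _ _
  refine LipschitzWith.continuous (K := (max M 0 * c.toReal).toNNReal)
    (LipschitzWith.of_dist_le_mul fun g g' => ?_)
  rw [Real.coe_toNNReal _ (by positivity), dist_eq_norm, ← integral_sub (hint g) (hint g')]
  have hgi : Integrable (g - g' : Lp X q μ) μ := (Lp.memLp _).integrable hq.out
  calc ‖∫ a, (T a (g a) - T a (g' a)) ∂μ‖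
      ≤ ∫ a, max M 0 * ‖(g - g' : Lp X q μ) a‖ ∂μ := by
        refine norm_integral_le_of_norm_le (hgi.norm.const_mul _) ?_
        filter_upwards [Lp.coeFn_sub g g'] with a ha
        rw [ha, Pi.sub_apply, ← map_sub]
        exact (ContinuousLinearMap.le_opNorm _ _).trans
          (mul_le_mul_of_nonneg_right ((hM a).trans (le_max_left _ _)) (norm_nonneg _))
    _ = max M 0 * (eLpNorm (g - g' : Lp X q μ) 1 μ).toReal := by
        rw [integral_const_mul, integral_norm_eq_lintegral_enorm hgi.1,
          eLpNorm_one_eq_lintegral_enorm]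
    _ ≤ max M 0 * (‖g - g'‖ * c.toReal) := by
        refine mul_le_mul_of_nonneg_left ?_ hMn
        rw [Lp.norm_def, ← ENNReal.toReal_mul]
        exact ENNReal.toReal_mono (ENNReal.mul_ne_top (Lp.eLpNorm_ne_top _) hctop)
          (eLpNorm_le_eLpNorm_mul_rpow_measure_univ hq.out (Lp.aestronglyMeasurable _))
    _ = max M 0 * c.toReal * dist g g' := by rw [dist_eq_norm]; ring

end Pairing

/-! ### The space `W^{1,p}_0(Q)` as a closure of test functions -/

section Sobolev

variable {d : ℕ} {Q : Set (E d)} {p : ℝ}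

lemma HasWeakGradZero.congr {u u' : E d → ℝ} {G G' : E d → E d}
    (hu : u =ᵐ[volume.restrict Q] u') (hG : G =ᵐ[volume.restrict Q] G')
    (h : HasWeakGradZero Q p u G) : HasWeakGradZero Q p u' G' := by
  refine ⟨⟨h.1.1.ae_eq hu, h.1.2.1.ae_eq hG, fun η hη => ?_⟩, fun ε hε => ?_⟩
  · rw [← integral_congr_ae (hu.mono fun x hx => congrArg (· • gradient η x) hx),
      ← integral_congr_ae (hG.mono fun x hx => congrArg (η x • ·) hx)]
    exact h.1.2.2 η hη
  · obtain ⟨η, h1, h2, h3⟩ := h.2 ε hε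
    refine ⟨η, h1, ?_, ?_⟩
    · rwa [eLpNorm_congr_ae (hu.mono fun x hx => congrArg (· - η x) hx)] at h2
    · rwa [eLpNorm_congr_ae (hG.mono fun x hx => congrArg (· - gradient η x) hx)] at h3

lemma memLp_integrable_restrict {F : Type*} [NormedAddCommGroup F]
    [IsFiniteMeasure (volume.restrict Q)]
    (hp : 1 < p) {g : E d → F} (hg : MemLp g (ENNReal.ofReal p) (volume.restrict Q)) :
    IntegrableOn g Q := memLp_integrable hp hg

/-- Weak gradients are unique. -/
lemma HasWeakGrad.ae_eq [IsFiniteMeasure (volume.restrict Q)] (hQ : IsOpen Q) (hp : 1 < p)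
    {u : E d → ℝ} {G G' : E d → E d}
    (h : HasWeakGrad Q p u G) (h' : HasWeakGrad Q p u G') : G =ᵐ[volume.restrict Q] G' := by
  have hG := memLp_integrable_restrict hp h.2.1
  have hG' := memLp_integrable_restrict hp h'.2.1
  have key := hQ.ae_eq_zero_of_integral_contDiff_smul_eq_zero (μ := volume)
    (f := fun x => G x - G' x) (hG.sub hG').locallyIntegrableOn fun η h1 h2 h3 => ?_
  · rw [EventuallyEq, ae_restrict_iff' hQ.measurableSet]
    exact key.mono fun x hx hxQ => sub_eq_zero.1 (hx hxQ)
  · have hη : IsTestFun Q η := ⟨h1, h2, h3⟩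
    have e : ∫ x, η x • (G x - G' x) = ∫ x in Q, η x • (G x - G' x) :=
      (setIntegral_eq_integral_of_forall_compl_eq_zero fun x hx => by
        rw [Function.notMem_support.1 (fun h0 => hx (hη.support_subset h0)), zero_smul]).symm
    obtain ⟨M, hM⟩ := h2.exists_bound_of_continuous hη.continuous
    have i : ∀ {H : E d → E d}, IntegrableOn H Q → Integrable (fun x => η x • H x)
        (volume.restrict Q) := fun hH =>
      hH.bdd_smul M hη.continuous.aestronglyMeasurable (.of_forall hM)
    rw [e]
    simp only [smul_sub]
    rw [integral_sub (i hG) (i hG')]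
    have e1 := h.2.2 η hη
    have e2 := h'.2.2 η hη
    rw [e1, neg_inj] at e2
    rw [e2, sub_self]

variable [Fact (1 ≤ ENNReal.ofReal p)]

/-- The pairs `(η,∇η)` for test functions `η`, in `L^1(Q) × L^p(Q)^d`. -/
def testPairs (Q : Set (E d)) (p : ℝ) :
    Set (Lp ℝ 1 (volume.restrict Q) × Lp (E d) (ENNReal.ofReal p) (volume.restrict Q)) :=
  {z | ∃ η, IsTestFun Q η ∧ z.1 =ᵐ[volume.restrict Q] η ∧
    z.2 =ᵐ[volume.restrict Q] gradient η}

lemma combo_mem_testPairs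
    {z z' : Lp ℝ 1 (volume.restrict Q) × Lp (E d) (ENNReal.ofReal p) (volume.restrict Q)}
    (hz : z ∈ testPairs Q p) (hz' : z' ∈ testPairs Q p) (a b : ℝ) :
    a • z + b • z' ∈ testPairs Q p := by
  obtain ⟨η, h, h1, h2⟩ := hz
  obtain ⟨η', h', h1', h2'⟩ := hz'
  refine ⟨_, h.combo h' a b, ?_, ?_⟩
  · filter_upwards [h1, h1', Lp.coeFn_add (a • z.1) (b • z'.1), Lp.coeFn_smul a z.1,
      Lp.coeFn_smul b z'.1] with x e1 e2 e3 e4 e5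
    simp only [Prod.fst_add, Prod.smul_fst]
    rw [e3, Pi.add_apply, e4, e5, Pi.smul_apply, Pi.smul_apply, e1, e2, smul_eq_mul, smul_eq_mul]
  · filter_upwards [h2, h2', Lp.coeFn_add (a • z.2) (b • z'.2), Lp.coeFn_smul a z.2,
      Lp.coeFn_smul b z'.2] with x e1 e2 e3 e4 e5
    simp only [Prod.snd_add, Prod.smul_snd]
    rw [e3, Pi.add_apply, e4, e5, Pi.smul_apply, Pi.smul_apply, e1, e2, h.gradient_combo h']

lemma convex_testPairs : Convex ℝ (testPairs Q p) :=
  fun _ hz _ hz' a b _ _ _ => combo_mem_testPairs hz hz' a b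

lemma IsTestFun.toLp_mem_testPairs {η : E d → ℝ} (h : IsTestFun Q η) :
    ((h.memLp 1).toLp η, (h.memLp_gradient (ENNReal.ofReal p)).toLp (gradient η)) ∈
      testPairs Q p :=
  ⟨η, h, (h.memLp 1).coeFn_toLp, (h.memLp_gradient _).coeFn_toLp⟩

/-- The Poincaré-type inequality passes to the closure by Fatou's lemma. In particular the function
component of an element of the closure is in `L^p(Q)`. -/
lemma exists_poincare_closure (hp : 1 < p) (hQ : MeasurableSet Q) (hQb : Bornology.IsBounded Q) :
    ∃ K : ℝ≥0∞, K ≠ ⊤ ∧ ∀ z ∈ closure (testPairs Q p),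
      eLpNorm z.1 (ENNReal.ofReal p) (volume.restrict Q) ≤ K * (‖z.2‖ₑ + ‖z.1‖ₑ) := by
  obtain ⟨K, hK, hKη⟩ := exists_poincare hp hQ hQb
  refine ⟨K, hK, fun z hz => ?_⟩
  obtain ⟨w, hw, hwz⟩ := mem_closure_iff_seq_limit.1 hz
  have hw1 : Tendsto (fun n => (w n).1) atTop (𝓝 z.1) := (continuous_fst.tendsto z).comp hwz
  have hw2 : Tendsto (fun n => (w n).2) atTop (𝓝 z.2) := (continuous_snd.tendsto z).comp hwz
  obtain ⟨φ, hφ, hae⟩ := (tendstoInMeasure_of_tendsto_Lp hw1).exists_seq_tendsto_ae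
  have hbound : ∀ n, eLpNorm (w n).1 (ENNReal.ofReal p) (volume.restrict Q) ≤
      K * (‖(w n).2‖ₑ + ‖(w n).1‖ₑ) := fun n => by
    obtain ⟨η, h, h1, h2⟩ := hw n
    rw [Lp.enorm_def, Lp.enorm_def, eLpNorm_congr_ae h1, eLpNorm_congr_ae h2, eLpNorm_congr_ae h1]
    exact hKη η h
  have hlim : Tendsto (fun n => K * (‖(w (φ n)).2‖ₑ + ‖(w (φ n)).1‖ₑ)) atTop
      (𝓝 (K * (‖z.2‖ₑ + ‖z.1‖ₑ))) :=
    ENNReal.Tendsto.const_mul (((continuous_enorm.tendsto _).comp hw2).add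
      ((continuous_enorm.tendsto _).comp hw1) |>.comp hφ.tendsto_atTop) (Or.inr hK)
  refine (Lp.eLpNorm_lim_le_liminf_eLpNorm
    (fun n => Lp.aestronglyMeasurable (w (φ n)).1) _ hae).trans ?_
  rw [← hlim.liminf_eq]
  exact liminf_le_liminf (.of_forall fun n => hbound (φ n))

/-- Integration by parts passes to the closure of test pairs. -/
lemma integral_smul_gradient_of_mem_closure [IsFiniteMeasure (volume.restrict Q)]
    {z : Lp ℝ 1 (volume.restrict Q) × Lp (E d) (ENNReal.ofReal p) (volume.restrict Q)}
    (hz : z ∈ closure (testPairs Q p)) {ψ : E d → ℝ} (hψ : IsTestFun Q ψ) :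
    ∫ x in Q, z.1 x • gradient ψ x = -∫ x in Q, ψ x • z.2 x := by
  obtain ⟨M, hM⟩ := hψ.2.1.exists_bound_of_continuous hψ.continuous
  obtain ⟨M', hM'⟩ :=
    hψ.hasCompactSupport_gradient.exists_bound_of_continuous hψ.continuous_gradient
  have c1 : Continuous fun g : Lp ℝ 1 (volume.restrict Q) => ∫ x in Q, g x • gradient ψ x := by
    refine continuous_integral_clm (M := M')
      (T := fun x => ContinuousLinearMap.toSpanSingleton ℝ (gradient ψ x)) ?_ fun x => ?_
    · exact ((LinearMap.continuous_of_finiteDimensional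
        (ContinuousLinearMap.toSpanSingletonLE ℝ ℝ (E d)).toLinearMap).comp
        hψ.continuous_gradient).aestronglyMeasurable
    · rw [ContinuousLinearMap.norm_toSpanSingleton]; exact hM' x
  have c2 : Continuous fun g : Lp (E d) (ENNReal.ofReal p) (volume.restrict Q) =>
      ∫ x in Q, ψ x • g x := by
    refine continuous_integral_clm (M := M)
      (T := fun x => ψ x • ContinuousLinearMap.id ℝ (E d)) ?_ fun x => ?_
    · exact (hψ.continuous.smul continuous_const).aestronglyMeasurable
    · rw [norm_smul]
      exact (mul_le_of_le_one_right (norm_nonneg _) ContinuousLinearMap.norm_id_le).trans (hM x)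
  have hcl : IsClosed {z : Lp ℝ 1 (volume.restrict Q) ×
      Lp (E d) (ENNReal.ofReal p) (volume.restrict Q) |
      ∫ x in Q, z.1 x • gradient ψ x = -∫ x in Q, ψ x • z.2 x} :=
    isClosed_eq (c1.comp continuous_fst) (c2.comp continuous_snd).neg
  refine hcl.closure_subset_iff.2 (fun w hw => ?_) hz
  obtain ⟨η, h, h1, h2⟩ := hw
  show ∫ x in Q, w.1 x • gradient ψ x = -∫ x in Q, ψ x • w.2 x
  rw [integral_congr_ae (h1.mono fun x hx => congrArg (· • gradient ψ x) hx),
    integral_congr_ae (h2.mono fun x hx => congrArg (ψ x • ·) hx)]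
  exact h.integral_smul_gradient hψ

/-- `W^{1,p}_0(Q)` is the closure of the test functions even if the functions themselves are only
controlled in `L^1(Q)`. -/
lemma hasWeakGradZero_iff_mem_closure (hp : 1 < p) (hQ : MeasurableSet Q)
    (hQb : Bornology.IsBounded Q) [IsFiniteMeasure (volume.restrict Q)]
    (z : Lp ℝ 1 (volume.restrict Q) × Lp (E d) (ENNReal.ofReal p) (volume.restrict Q)) :
    HasWeakGradZero Q p z.1 z.2 ↔ z ∈ closure (testPairs Q p) := by
  constructor
  · intro h
    rw [EMetric.mem_closure_iff]
    intro ε hε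
    -- The norm of the embedding of `L^p(Q)` into `L^1(Q)`.
    set c : ℝ≥0∞ := volume.restrict Q univ ^
      (1 / (1 : ℝ≥0∞).toReal - 1 / (ENNReal.ofReal p).toReal) with hc
    have hctop : c ≠ ⊤ := by
      refine ENNReal.rpow_ne_top_of_nonneg ?_ (measure_ne_top _ _)
      rw [ENNReal.toReal_ofReal (by linarith), ENNReal.toReal_one, sub_nonneg]
      exact one_div_le_one_div_of_le one_pos hp.le
    obtain ⟨ε', hε', hε'ε⟩ : ∃ ε' : ℝ≥0∞, 0 < ε' ∧ ε' * (c + 1) < ε := by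
      obtain ⟨ε'', h0, hlt⟩ := exists_between hε
      have hc1 : c + 1 ≠ ⊤ := ENNReal.add_ne_top.2 ⟨hctop, ENNReal.one_ne_top⟩
      refine ⟨ε'' / (c + 1), ENNReal.div_pos h0.ne' hc1, ?_⟩
      rwa [ENNReal.div_mul_cancel (by simp) hc1]
    obtain ⟨η, hη, h1, h2⟩ := h.2 ε' hε'
    refine ⟨_, hη.toLp_mem_testPairs, ?_⟩
    rw [Prod.edist_eq, max_lt_iff]
    constructor
    · rw [Lp.edist_def, eLpNorm_congr_ae ((EventuallyEq.refl _ z.1).sub (MemLp.coeFn_toLp _))]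
      refine lt_of_le_of_lt (eLpNorm_le_eLpNorm_mul_rpow_measure_univ (q := ENNReal.ofReal p)
        (Fact.out) ((Lp.aestronglyMeasurable _).sub (hη.memLp 1).1)) ?_
      refine lt_of_le_of_lt ?_ hε'ε
      exact mul_le_mul' h1.le le_self_add
    · rw [Lp.edist_def, eLpNorm_congr_ae ((EventuallyEq.refl _ z.2).sub (MemLp.coeFn_toLp _))]
      refine lt_of_lt_of_le h2 (le_trans ?_ hε'ε.le)
      exact le_mul_of_one_le_right' le_add_self
  · intro hz
    obtain ⟨K, hK, hKz⟩ := exists_poincare_closure hp hQ hQb (p := p)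
    refine ⟨⟨⟨Lp.aestronglyMeasurable _, (hKz z hz).trans_lt ?_⟩, Lp.memLp _,
      fun ψ hψ => integral_smul_gradient_of_mem_closure hz hψ⟩, fun ε hε => ?_⟩
    · exact ENNReal.mul_lt_top hK.lt_top
        (ENNReal.add_lt_top.2 ⟨enorm_lt_top, enorm_lt_top⟩)
    · obtain ⟨w, hw, hwz⟩ := mem_closure_iff_seq_limit.1 hz
      have hlim : Tendsto (fun n => K * (‖(z - w n).2‖ₑ + ‖(z - w n).1‖ₑ)) atTop (𝓝 0) := by
        have h0 : Tendsto (fun n => z - w n) atTop (𝓝 0) := by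
          simpa using tendsto_const_nhds (x := z).sub hwz
        have hc : Continuous fun y : Lp ℝ 1 (volume.restrict Q) ×
            Lp (E d) (ENNReal.ofReal p) (volume.restrict Q) => ‖y.2‖ₑ + ‖y.1‖ₑ := by fun_prop
        have := ENNReal.Tendsto.const_mul ((hc.tendsto 0).comp h0) (Or.inr hK)
        simpa using this
      have hlim2 : Tendsto (fun n => ‖(z - w n).2‖ₑ) atTop (𝓝 0) := by
        have h0 : Tendsto (fun n => z - w n) atTop (𝓝 0) := by
          simpa using tendsto_const_nhds (x := z).sub hwz
        have hc : Continuous fun y : Lp ℝ 1 (volume.restrict Q) ×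
            Lp (E d) (ENNReal.ofReal p) (volume.restrict Q) => ‖y.2‖ₑ := by fun_prop
        simpa [Function.comp_def] using (hc.tendsto 0).comp h0
      obtain ⟨n, hn, hn2⟩ := ((hlim.eventually (gt_mem_nhds hε)).and
        (hlim2.eventually (gt_mem_nhds hε))).exists
      have hzw : z - w n ∈ closure (testPairs Q p) := by
        have hconv : ∀ y ∈ closure (testPairs Q p), y - w n ∈ closure (testPairs Q p) := by
          intro y hy
          refine map_mem_closure (f := fun y => y - w n) (by fun_prop) hy fun y hy => ?_
          have := combo_mem_testPairs hy (hw n) 1 (-1)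
          simpa [sub_eq_add_neg] using this
        exact hconv z hz
      obtain ⟨η, h, h1, h2⟩ := hw n
      refine ⟨η, h, lt_of_le_of_lt (le_of_eq ?_) ((hKz _ hzw).trans_lt hn),
        lt_of_le_of_lt (le_of_eq ?_) hn2⟩
      · refine eLpNorm_congr_ae ?_
        filter_upwards [h1, Lp.coeFn_sub z.1 (w n).1] with x e1 e2
        rw [Prod.fst_sub, e2, Pi.sub_apply, e1]
      · rw [Lp.enorm_def]
        refine eLpNorm_congr_ae ?_
        filter_upwards [h2, Lp.coeFn_sub z.2 (w n).2] with x e1 e2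
        rw [Prod.snd_sub, e2, Pi.sub_apply, e1]

end Sobolev

/-! ### Uniform convexity of `L^p` and projections of closed convex sets -/

section UniformConvexity

/-- The defect in the convexity inequality of `‖·‖^p` at the midpoint. -/
noncomputable def midpointDefect {X : Type*} [NormedAddCommGroup X] [NormedSpace ℝ X] (p : ℝ)
    (a b : X) : ℝ :=
  (‖a‖ ^ p + ‖b‖ ^ p) / 2 - ‖(1 / 2 : ℝ) • (a + b)‖ ^ p

lemma midpointDefect_nonneg {X : Type*} [NormedAddCommGroup X] [NormedSpace ℝ X] {p : ℝ}
    (hp : 1 < p) (a b : X) : 0 ≤ midpointDefect p a b := by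
  have h := (convexOn_norm_rpow hp).2 (mem_univ a) (mem_univ b)
    (by norm_num : (0 : ℝ) ≤ 1 / 2) (by norm_num : (0 : ℝ) ≤ 1 / 2) (by norm_num)
  simp only [← smul_add, smul_eq_mul] at h
  unfold midpointDefect
  linarith

lemma eq_of_midpointDefect_eq_zero {X : Type*} [NormedAddCommGroup X] [NormedSpace ℝ X]
    [StrictConvexSpace ℝ X] {p : ℝ} (hp : 1 < p) {a b : X} (h : midpointDefect p a b = 0) :
    a = b := by
  have hp0 : 0 < p := by linarith
  unfold midpointDefect at h
  have e : ‖(1 / 2 : ℝ) • (a + b)‖ = (1 / 2) * ‖a + b‖ := by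
    rw [norm_smul]; norm_num
  have h1 : ‖(1 / 2 : ℝ) • (a + b)‖ ≤ (1 / 2) * ‖a‖ + (1 / 2) * ‖b‖ := by
    rw [e]; linarith [norm_add_le a b]
  have h2 : ‖(1 / 2 : ℝ) • (a + b)‖ ^ p ≤ ((1 / 2) * ‖a‖ + (1 / 2) * ‖b‖) ^ p :=
    Real.rpow_le_rpow (norm_nonneg _) h1 hp0.le
  have hab : ‖a‖ = ‖b‖ := by
    by_contra hne
    have h3 := (strictConvexOn_rpow hp).2 (norm_nonneg a) (norm_nonneg b) hne
      (by norm_num : (0 : ℝ) < 1 / 2) (by norm_num : (0 : ℝ) < 1 / 2) (by norm_num)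
    simp only [smul_eq_mul] at h3
    linarith
  refine eq_of_norm_eq_of_norm_add_eq hab ?_
  by_contra hne
  have h4 : ‖a + b‖ < ‖a‖ + ‖b‖ := lt_of_le_of_ne (norm_add_le _ _) hne
  have h5 : ‖(1 / 2 : ℝ) • (a + b)‖ < ‖a‖ := by rw [e]; linarith
  have h6 := Real.rpow_lt_rpow (norm_nonneg _) h5 hp0
  rw [← hab] at h
  linarith

lemma midpointDefect_smul {X : Type*} [NormedAddCommGroup X] [NormedSpace ℝ X] (p : ℝ) {t : ℝ}
    (ht : 0 ≤ t) (a b : X) : midpointDefect p (t • a) (t • b) = t ^ p * midpointDefect p a b := by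
  unfold midpointDefect
  rw [← smul_add, smul_comm, norm_smul, norm_smul, norm_smul t ((1 / 2 : ℝ) • (a + b)),
    Real.norm_of_nonneg ht, Real.mul_rpow ht (norm_nonneg _), Real.mul_rpow ht (norm_nonneg _),
    Real.mul_rpow ht (norm_nonneg _)]
  ring

/-- Uniform convexity of `‖·‖^p` in a finite-dimensional strictly convex space: by homogeneity it
suffices to consider a compact sphere, on which the midpoint defect vanishes only on the
diagonal. -/
lemma exists_norm_sub_rpow_le {X : Type*} [NormedAddCommGroup X] [NormedSpace ℝ X]
    [FiniteDimensional ℝ X] [StrictConvexSpace ℝ X] {p : ℝ} (hp : 1 < p) {ε : ℝ} (hε : 0 < ε) :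
    ∃ K : ℝ, 0 ≤ K ∧ ∀ a b : X,
      ‖a - b‖ ^ p ≤ ε * (‖a‖ ^ p + ‖b‖ ^ p) + K * midpointDefect p a b := by
  have hp0 : 0 < p := by linarith
  have hcn : ∀ {g : X × X → X}, Continuous g → Continuous fun z => ‖g z‖ ^ p := fun hg =>
    hg.norm.rpow_const fun _ => Or.inr hp0.le
  have hcd : Continuous fun z : X × X => midpointDefect p z.1 z.2 := by
    unfold midpointDefect
    exact (((hcn continuous_fst).add (hcn continuous_snd)).div_const 2).sub
      (hcn (by fun_prop))
  set S : Set (X × X) := Metric.sphere 0 1 ∩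
    {z | ε * (‖z.1‖ ^ p + ‖z.2‖ ^ p) ≤ ‖z.1 - z.2‖ ^ p} with hS
  have hScomp : IsCompact S := (isCompact_sphere _ _).inter_right
    (isClosed_le (continuous_const.mul ((hcn continuous_fst).add (hcn continuous_snd)))
      (hcn (continuous_fst.sub continuous_snd)))
  have hpos : ∀ z ∈ S, 0 < midpointDefect p z.1 z.2 := by
    rintro ⟨a, b⟩ ⟨h1, h2⟩
    refine lt_of_le_of_ne (midpointDefect_nonneg hp _ _) fun h0 => ?_
    have hab : a = b := eq_of_midpointDefect_eq_zero hp h0.symm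
    subst hab
    simp only [mem_ofPred_eq, sub_self, norm_zero, Real.zero_rpow hp0.ne'] at h2
    have h3 : ‖a‖ ^ p ≤ 0 := by nlinarith
    have h4 : ‖a‖ ^ p = 0 := le_antisymm h3 (by positivity)
    have h5 : a = 0 := by
      rw [Real.rpow_eq_zero (norm_nonneg _) hp0.ne'] at h4
      exact norm_eq_zero.1 h4
    subst h5
    simp at h1
  obtain ⟨c, hc, hcS⟩ : ∃ c : ℝ, 0 < c ∧ ∀ z ∈ S, c ≤ midpointDefect p z.1 z.2 := by
    rcases S.eq_empty_or_nonempty with h | h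
    · exact ⟨1, one_pos, by simp [h]⟩
    · obtain ⟨z, hz, hmin⟩ := hScomp.exists_isMinOn h hcd.continuousOn
      exact ⟨_, hpos z hz, fun w hw => hmin hw⟩
  -- On `S` the defect term alone exceeds `2 ^ p ≥ ‖a - b‖ ^ p`; off `S` the first term suffices.
  refine ⟨2 ^ p / c, by positivity, ?_⟩
  have hsphere : ∀ a b : X, ‖(a, b)‖ = 1 →
      ‖a - b‖ ^ p ≤ ε * (‖a‖ ^ p + ‖b‖ ^ p) + 2 ^ p / c * midpointDefect p a b := by
    intro a b hab
    have hd := midpointDefect_nonneg hp a b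
    by_cases hmem : (a, b) ∈ S
    · have h1 : ‖a - b‖ ≤ 2 := by
        have h2 : ‖a‖ ≤ 1 := hab ▸ norm_fst_le (a, b)
        have h3 : ‖b‖ ≤ 1 := hab ▸ norm_snd_le (a, b)
        linarith [norm_sub_le a b]
      have h4 : ‖a - b‖ ^ p ≤ 2 ^ p := Real.rpow_le_rpow (norm_nonneg _) h1 hp0.le
      have h5 : (2 : ℝ) ^ p ≤ 2 ^ p / c * midpointDefect p a b := by
        rw [div_mul_eq_mul_div, le_div_iff₀ hc]
        exact mul_le_mul_of_nonneg_left (hcS _ hmem) (by positivity)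
      have h6 : 0 ≤ ε * (‖a‖ ^ p + ‖b‖ ^ p) := by positivity
      linarith
    · have h1 : ‖a - b‖ ^ p < ε * (‖a‖ ^ p + ‖b‖ ^ p) := by
        by_contra h
        exact hmem ⟨by simpa using hab, not_lt.1 h⟩
      have h2 : 0 ≤ 2 ^ p / c * midpointDefect p a b := by positivity
      linarith
  intro a b
  rcases eq_or_ne (a, b) 0 with h0 | h0
  · obtain ⟨rfl, rfl⟩ := Prod.mk_eq_zero.1 h0
    simp [midpointDefect, Real.zero_rpow hp0.ne']
  · set t := ‖(a, b)‖ with ht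
    have ht0 : 0 < t := norm_pos_iff.2 h0
    have h1 := hsphere (t⁻¹ • a) (t⁻¹ • b) (by
      rw [← Prod.smul_mk, norm_smul, norm_inv, norm_norm, inv_mul_cancel₀ ht0.ne'])
    have htp : 0 < t⁻¹ ^ p := by positivity
    rw [midpointDefect_smul p (by positivity), ← smul_sub, norm_smul, norm_smul, norm_smul,
      Real.norm_of_nonneg (by positivity : 0 ≤ t⁻¹), Real.mul_rpow (by positivity) (norm_nonneg _),
      Real.mul_rpow (by positivity) (norm_nonneg _), Real.mul_rpow (by positivity) (norm_nonneg _)]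
      at h1
    refine le_of_mul_le_mul_left (a := t⁻¹ ^ p) ?_ htp
    linarith

/-- Uniform convexity of `L^p`, by integration of the pointwise inequality. -/
lemma Lp_exists_norm_sub_rpow_le {α X : Type*} [MeasurableSpace α] {μ : Measure α}
    [NormedAddCommGroup X] [NormedSpace ℝ X] [FiniteDimensional ℝ X] [StrictConvexSpace ℝ X]
    {p : ℝ} (hp : 1 < p) [Fact (1 ≤ ENNReal.ofReal p)] {ε : ℝ} (hε : 0 < ε) :
    ∃ K : ℝ, 0 ≤ K ∧ ∀ g g' : Lp X (ENNReal.ofReal p) μ,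
      ‖g - g'‖ ^ p ≤ ε * (‖g‖ ^ p + ‖g'‖ ^ p) + K * midpointDefect p g g' := by
  obtain ⟨K, hK, h⟩ := exists_norm_sub_rpow_le (X := X) hp hε
  refine ⟨K, hK, fun g g' => ?_⟩
  have i1 := Lp_integrable_norm_rpow hp g
  have i2 := Lp_integrable_norm_rpow hp g'
  have i3 := Lp_integrable_norm_rpow hp ((1 / 2 : ℝ) • (g + g'))
  have i12 : Integrable (fun a => ‖g a‖ ^ p + ‖g' a‖ ^ p) μ := i1.add i2
  have i4 : Integrable (fun a => (‖g a‖ ^ p + ‖g' a‖ ^ p) / 2 -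
      ‖((1 / 2 : ℝ) • (g + g') : Lp X (ENNReal.ofReal p) μ) a‖ ^ p) μ := (i12.div_const 2).sub i3
  rw [midpointDefect, Lp_norm_rpow_eq hp, Lp_norm_rpow_eq hp g, Lp_norm_rpow_eq hp g',
    Lp_norm_rpow_eq hp ((1 / 2 : ℝ) • (g + g')), ← integral_add i1 i2, ← integral_div,
    ← integral_sub (i12.div_const 2) i3, ← integral_const_mul, ← integral_const_mul,
    ← integral_add (i12.const_mul ε) (i4.const_mul K)]
  refine integral_mono_ae (Lp_integrable_norm_rpow hp _) ((i12.const_mul ε).add (i4.const_mul K)) ?_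
  filter_upwards [Lp.coeFn_sub g g', Lp.coeFn_smul (1 / 2 : ℝ) (g + g'), Lp.coeFn_add g g']
    with a e1 e2 e3
  rw [e1, e2, Pi.smul_apply, e3]
  exact h (g a) (g' a)

/-- The projection of a closed convex set `𝒦 ⊆ Z × X` to `Z` is closed if the second components are
bounded and `X` is uniformly convex. Elements of `𝒦` whose first component approaches `v` and whose
second component has almost minimal norm form a Cauchy sequence in `X`; this replaces weak
compactness of bounded sets. -/
lemma exists_mem_of_mem_closure_fst_image {Z X : Type*} [NormedAddCommGroup Z] [NormedSpace ℝ Z]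
    [NormedAddCommGroup X] [NormedSpace ℝ X] [CompleteSpace X] {p : ℝ} (hp : 1 < p)
    (hX : ∀ ε : ℝ, 0 < ε → ∃ K : ℝ, 0 ≤ K ∧ ∀ g g' : X,
      ‖g - g'‖ ^ p ≤ ε * (‖g‖ ^ p + ‖g'‖ ^ p) + K * midpointDefect p g g')
    {𝒦 : Set (Z × X)} (hconv : Convex ℝ 𝒦) (hcl : IsClosed 𝒦) {R : ℝ}
    (hR : ∀ z ∈ 𝒦, ‖z.2‖ ^ p ≤ R) {v : Z} (hv : v ∈ closure (Prod.fst '' 𝒦)) :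
    ∃ g : X, (v, g) ∈ 𝒦 := by
  have hp0 : 0 < p := by linarith
  set ρ : ℕ → ℝ := fun n => 1 / ((n : ℝ) + 1) with hρ
  have hρpos : ∀ n, 0 < ρ n := fun n => Nat.one_div_pos_of_nat
  have hρlim : Tendsto ρ atTop (𝓝 0) := tendsto_one_div_add_atTop_nhds_zero_nat
  have hρanti : ∀ {n k}, n ≤ k → ρ k ≤ ρ n := fun h => Nat.one_div_le_one_div h
  -- `A n` are the candidates within `ρ n` of `v`, and `m n` is their least energy.
  set A : ℕ → Set (Z × X) := fun n => {z | z ∈ 𝒦 ∧ dist z.1 v < ρ n} with hA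
  have hAne : ∀ n, (A n).Nonempty := fun n => by
    obtain ⟨_, ⟨z, hz, rfl⟩, hd⟩ := Metric.mem_closure_iff.1 hv (ρ n) (hρpos n)
    exact ⟨z, hz, by rwa [dist_comm]⟩
  have hAanti : ∀ {n k}, n ≤ k → A k ⊆ A n := fun h z hz =>
    ⟨hz.1, hz.2.trans_le (hρanti h)⟩
  have hAconv : ∀ n, Convex ℝ (A n) := fun n =>
    hconv.inter ((convex_ball v (ρ n)).linear_preimage (LinearMap.fst ℝ Z X))
  set m : ℕ → ℝ := fun n => sInf ((fun z : Z × X => ‖z.2‖ ^ p) '' A n) with hm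
  have hbdd : ∀ n, BddBelow ((fun z : Z × X => ‖z.2‖ ^ p) '' A n) := fun n =>
    ⟨0, by rintro _ ⟨z, _, rfl⟩; positivity⟩
  have hmle : ∀ n, ∀ z ∈ A n, m n ≤ ‖z.2‖ ^ p := fun n z hz => csInf_le (hbdd n) ⟨z, hz, rfl⟩
  have hmono : Monotone m := fun n k h =>
    csInf_le_csInf (hbdd n) ((hAne k).image _) (image_mono (hAanti h))
  have hmR : ∀ n, m n ≤ R := fun n => by
    obtain ⟨z, hz⟩ := hAne n
    exact (hmle n z hz).trans (hR z hz.1)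
  obtain ⟨L, hL⟩ : ∃ L, Tendsto m atTop (𝓝 L) :=
    ⟨_, tendsto_atTop_ciSup hmono ⟨R, by rintro _ ⟨n, rfl⟩; exact hmR n⟩⟩
  have hmL : ∀ n, m n ≤ L := hmono.ge_of_tendsto hL
  have hex : ∀ n, ∃ z ∈ A n, ‖z.2‖ ^ p < m n + ρ n := fun n => by
    obtain ⟨_, ⟨z, hz, rfl⟩, h⟩ :=
      exists_lt_of_csInf_lt ((hAne n).image _) (lt_add_of_pos_right (m n) (hρpos n))
    exact ⟨z, hz, h⟩
  choose z hzA hzm using hex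
  have hR0 : 0 ≤ R := le_trans (by positivity) (hR _ (hzA 0).1)
  have hcauchy : CauchySeq fun n => (z n).2 := by
    rw [Metric.cauchySeq_iff']
    intro η hη
    have hηp : 0 < η ^ p := by positivity
    obtain ⟨K, hK, hKX⟩ := hX (η ^ p / (4 * (R + 1))) (by positivity)
    have hlim : Tendsto (fun n => K * ((L - m n) / 2 + ρ n)) atTop (𝓝 0) := by
      have := (((tendsto_const_nhds (x := L)).sub hL).div_const 2).add hρlim
      simpa using this.const_mul K
    obtain ⟨N, hN⟩ := (hlim.eventually (gt_mem_nhds (half_pos hηp))).exists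
    refine ⟨N, fun n hn => ?_⟩
    rw [dist_eq_norm]
    refine lt_of_not_ge fun hge => ?_
    have h1 := Real.rpow_le_rpow hη.le hge hp0.le
    have h2 := hKX (z n).2 (z N).2
    -- The midpoint is again a candidate, so its energy is at least `m N` and the defect is small.
    have hmid : (1 / 2 : ℝ) • (z n + z N) ∈ A N := by
      rw [smul_add]
      exact hAconv N (hAanti hn (hzA n)) (hzA N) (by norm_num) (by norm_num) (by norm_num)
    have h3 : m N ≤ ‖(1 / 2 : ℝ) • ((z n).2 + (z N).2)‖ ^ p := hmle N _ hmid
    have h4 : midpointDefect p (z n).2 (z N).2 ≤ (L - m N) / 2 + ρ N := by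
      unfold midpointDefect
      linarith [hzm n, hzm N, hmL n, hρanti hn]
    have h5 := mul_le_mul_of_nonneg_left h4 hK
    have h6 : η ^ p / (4 * (R + 1)) * (‖(z n).2‖ ^ p + ‖(z N).2‖ ^ p) ≤ η ^ p / 2 := by
      rw [div_mul_eq_mul_div, div_le_div_iff₀ (by positivity) (by norm_num)]
      nlinarith [hR _ (hzA n).1, hR _ (hzA N).1]
    linarith
  obtain ⟨g, hg⟩ := cauchySeq_tendsto_of_complete hcauchy
  refine ⟨g, hcl.mem_of_tendsto (f := z) (b := atTop) ?_ (.of_forall fun n => (hzA n).1)⟩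
  refine Tendsto.prodMk_nhds ?_ hg
  rw [tendsto_iff_dist_tendsto_zero]
  exact squeeze_zero (fun _ => dist_nonneg) (fun n => (hzA n).2.le) hρlim

end UniformConvexity

/-! ### Mosco convergence -/

section Mosco

variable {Ω : Type*} [MeasurableSpace Ω] {P : Measure Ω} [IsProbabilityMeasure P] [IsSeparable P]
  {d : ℕ} {τ : E d → Ω → Ω} {p C : ℝ} [Fact (1 ≤ ENNReal.ofReal p)] [Fact (ENNReal.ofReal p ≠ ⊤)]
  {lam : Ω → ℝ} {Q : Set (E d)} [IsFiniteMeasure (volume.restrict Q)] {V : Ω → E d → E d → ℝ}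

lemma ehomReg_zero : EhomReg P τ p Q V 0 = Ehom P τ p Q V := by
  rw [EhomReg, Ehom, vhomReg_zero]

lemma IsDegenerateField.ehomReg_eq (hV : IsDegenerateField P p C lam Q V) (hp : 1 < p)
    (hτ : IsDynamicalSystem P τ) (hQo : IsOpen Q) {δ : ℝ} (hδ : 0 ≤ δ)
    {u : Lp ℝ 1 (volume.restrict Q)} {G : E d → E d} (h : HasWeakGradZero Q p u G) :
    EhomReg P τ p Q V δ u = (homFunctional P τ p Q V δ G : EReal) := by
  have hex : ∃ G : E d → E d, HasWeakGradZero Q p u G := ⟨G, h⟩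
  rw [EhomReg, energy, dif_pos hex, hV.extIntegral_vhomReg hp hτ hδ hex.choose_spec.1.2.1]
  congr 1
  refine integral_congr_ae ?_
  filter_upwards [hex.choose_spec.1.ae_eq hQo hp h.1] with x hx
  rw [hx]

lemma ehomReg_eq_top {δ : ℝ} {u : Lp ℝ 1 (volume.restrict Q)}
    (h : ¬ ∃ G : E d → E d, HasWeakGradZero Q p u G) : EhomReg P τ p Q V δ u = ⊤ := by
  rw [EhomReg, energy, dif_neg h]

lemma IsDegenerateField.ehomReg_ne_bot (hV : IsDegenerateField P p C lam Q V) (hp : 1 < p)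
    (hτ : IsDynamicalSystem P τ) (hQo : IsOpen Q) {δ : ℝ} (hδ : 0 ≤ δ)
    (u : Lp ℝ 1 (volume.restrict Q)) : EhomReg P τ p Q V δ u ≠ ⊥ := by
  by_cases h : ∃ G : E d → E d, HasWeakGradZero Q p u G
  · obtain ⟨G, hG⟩ := h
    rw [hV.ehomReg_eq hp hτ hQo hδ hG]
    exact EReal.coe_ne_bot _
  · rw [ehomReg_eq_top h]
    exact top_ne_bot

lemma ehom_le_ehomReg {δ : ℝ} (hδ : 0 ≤ δ) (u : Lp ℝ 1 (volume.restrict Q)) :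
    Ehom P τ p Q V u ≤ EhomReg P τ p Q V δ u := by
  by_cases h : ∃ G : E d → E d, HasWeakGradZero Q p u G
  · rw [EhomReg, Ehom, energy, energy, dif_pos h, dif_pos h]
    exact extIntegral_mono_ae (.of_forall fun x => vhom_le_vhomReg hδ x _)
  · rw [ehomReg_eq_top h]
    exact le_top

/-- The sublevel sets of the energy, lifted to pairs of a function and its gradient. -/
def liftedSublevel (P : Measure Ω) (τ : E d → Ω → Ω) (p : ℝ) [Fact (1 ≤ ENNReal.ofReal p)]
    (Q : Set (E d)) (V : Ω → E d → E d → ℝ) (M : ℝ) :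
    Set (Lp ℝ 1 (volume.restrict Q) × Lp (E d) (ENNReal.ofReal p) (volume.restrict Q)) :=
  closure (testPairs Q p) ∩ {z | homFunctional P τ p Q V 0 z.2 ≤ M}

lemma IsDegenerateField.image_liftedSublevel (hV : IsDegenerateField P p C lam Q V) (hp : 1 < p)
    (hτ : IsDynamicalSystem P τ) (hQo : IsOpen Q) (hQb : Bornology.IsBounded Q) (M : ℝ) :
    Prod.fst '' liftedSublevel P τ p Q V M = {u | Ehom P τ p Q V u ≤ M} := by
  ext u
  constructor
  · rintro ⟨z, ⟨hz, hM⟩, rfl⟩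
    have h := (hasWeakGradZero_iff_mem_closure hp hQo.measurableSet hQb z).2 hz
    rw [mem_ofPred_eq, ← ehomReg_zero, hV.ehomReg_eq hp hτ hQo le_rfl h]
    exact EReal.coe_le_coe_iff.2 hM
  · intro hu
    rw [mem_ofPred_eq, ← ehomReg_zero] at hu
    have hex : ∃ G : E d → E d, HasWeakGradZero Q p u G := by
      by_contra h
      rw [ehomReg_eq_top h] at hu
      exact absurd hu (not_le.2 (EReal.coe_lt_top M))
    obtain ⟨G, hG⟩ := hex
    have hGL : HasWeakGradZero Q p u (hG.1.2.1.toLp G) :=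
      hG.congr (EventuallyEq.refl _ _) hG.1.2.1.coeFn_toLp.symm
    refine ⟨(u, hG.1.2.1.toLp G), ⟨?_, ?_⟩, rfl⟩
    · exact (hasWeakGradZero_iff_mem_closure hp hQo.measurableSet hQb _).1 hGL
    · rw [hV.ehomReg_eq hp hτ hQo le_rfl hGL] at hu
      exact EReal.coe_le_coe_iff.1 hu

lemma IsDegenerateField.convex_liftedSublevel (hV : IsDegenerateField P p C lam Q V) (hp : 1 < p)
    (hτ : IsDynamicalSystem P τ) (M : ℝ) : Convex ℝ (liftedSublevel P τ p Q V M) := by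
  refine convex_testPairs.closure.inter ?_
  have h := (hV.convexOn_homFunctional hp hτ le_rfl).convex_le M
  simp only [mem_univ, true_and] at h
  exact h.linear_preimage (LinearMap.snd ℝ (Lp ℝ 1 (volume.restrict Q)) _)

lemma IsDegenerateField.isClosed_liftedSublevel (hV : IsDegenerateField P p C lam Q V)
    (hp : 1 < p) (hτ : IsDynamicalSystem P τ) (M : ℝ) : IsClosed (liftedSublevel P τ p Q V M) :=
  isClosed_closure.inter (isClosed_le
    ((hV.continuous_homFunctional hp hτ le_rfl).comp continuous_snd) continuous_const)

lemma IsDegenerateField.convex_sublevel (hV : IsDegenerateField P p C lam Q V) (hp : 1 < p)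
    (hτ : IsDynamicalSystem P τ) (hQo : IsOpen Q) (hQb : Bornology.IsBounded Q) (M : ℝ) :
    Convex ℝ {u | Ehom P τ p Q V u ≤ M} := by
  rw [← hV.image_liftedSublevel hp hτ hQo hQb]
  exact (hV.convex_liftedSublevel hp hτ M).linear_image (LinearMap.fst ℝ _ _)

lemma IsDegenerateField.isClosed_sublevel (hV : IsDegenerateField P p C lam Q V) (hp : 1 < p)
    (hτ : IsDynamicalSystem P τ) (hQo : IsOpen Q) (hQb : Bornology.IsBounded Q) (M : ℝ) :
    IsClosed {u | Ehom P τ p Q V u ≤ M} := by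
  rw [← hV.image_liftedSublevel hp hτ hQo hQb]
  refine isClosed_of_closure_subset fun u hu => ?_
  have hC := hV.weight.pos
  have hR : ∀ z ∈ liftedSublevel P τ p Q V M,
      ‖z.2‖ ^ p ≤ C * (M + C * (volume.restrict Q).real univ) := fun z hz => by
    have h1 := hV.le_homFunctional hp hτ le_rfl z.2
    have h2 : homFunctional P τ p Q V 0 z.2 ≤ M := hz.2
    have h3 : C⁻¹ * ‖z.2‖ ^ p ≤ M + C * (volume.restrict Q).real univ := by linarith
    rwa [inv_mul_le_iff₀ hC] at h3
  obtain ⟨g, hg⟩ := exists_mem_of_mem_closure_fst_image hp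
    (fun ε hε => Lp_exists_norm_sub_rpow_le hp hε) (hV.convex_liftedSublevel hp hτ M)
    (hV.isClosed_liftedSublevel hp hτ M) hR hu
  exact ⟨_, hg, rfl⟩

/-- The homogenized energy is weakly lower semicontinuous: its sublevel sets are closed and convex,
so they can be separated from outside points by continuous functionals. -/
lemma IsDegenerateField.le_liminf (hV : IsDegenerateField P p C lam Q V) (hp : 1 < p)
    (hτ : IsDynamicalSystem P τ) (hQo : IsOpen Q) (hQb : Bornology.IsBounded Q)
    {u : ℝ → Lp ℝ 1 (volume.restrict Q)} {u₀ : Lp ℝ 1 (volume.restrict Q)}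
    (hu : ∀ ℓ : StrongDual ℝ (Lp ℝ 1 (volume.restrict Q)),
      Tendsto (fun δ => ℓ (u δ)) (𝓝[>] 0) (𝓝 (ℓ u₀))) :
    Ehom P τ p Q V u₀ ≤ liminf (fun δ => EhomReg P τ p Q V δ (u δ)) (𝓝[>] 0) := by
  by_contra hlt
  obtain ⟨M, hM1, hM2⟩ := EReal.lt_iff_exists_real_btwn.1 (not_le.1 hlt)
  have hfreq : ∃ᶠ δ in 𝓝[>] 0, EhomReg P τ p Q V δ (u δ) < M :=
    frequently_lt_of_liminf_lt (by isBoundedDefault) hM1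
  obtain ⟨ℓ, s, hs, hs0⟩ := geometric_hahn_banach_closed_point
    (hV.convex_sublevel hp hτ hQo hQb M) (hV.isClosed_sublevel hp hτ hQo hQb M)
    (x := u₀) (fun h => absurd hM2 (not_lt.2 h))
  obtain ⟨δ, h1, h2, hδ⟩ := (hfreq.and_eventually
    (((hu ℓ).eventually (lt_mem_nhds hs0)).and self_mem_nhdsWithin)).exists
  have hδ : (0 : ℝ) < δ := hδ
  exact absurd (hs (u δ) ((ehom_le_ehomReg hδ.le _).trans h1.le)) (not_lt.2 h2.le)

/-- Constant families are recovery families. -/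
lemma IsDegenerateField.tendsto_ehomReg (hV : IsDegenerateField P p C lam Q V) (hp : 1 < p)
    (hτ : IsDynamicalSystem P τ) (hQo : IsOpen Q) (u : Lp ℝ 1 (volume.restrict Q)) :
    Tendsto (fun δ => EhomReg P τ p Q V δ u) (𝓝[>] 0) (𝓝 (Ehom P τ p Q V u)) := by
  by_cases h : ∃ G : E d → E d, HasWeakGradZero Q p u G
  · obtain ⟨G, hG⟩ := h
    rw [← ehomReg_zero, hV.ehomReg_eq hp hτ hQo le_rfl hG]
    refine ((continuous_coe_real_ereal.tendsto _).comp
      (hV.tendsto_homFunctional hp hτ hG.1.2.1)).congr' ?_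
    filter_upwards [self_mem_nhdsWithin] with δ hδ
    exact (hV.ehomReg_eq hp hτ hQo (le_of_lt hδ) hG).symm
  · rw [← ehomReg_zero]
    simp only [ehomReg_eq_top h]
    exact tendsto_const_nhds

end Mosco

end StochHom

theorem lemma4p4 {Ω : Type*} [MeasurableSpace Ω] (P : MeasureTheory.Measure Ω)
    [MeasureTheory.IsProbabilityMeasure P] [P.IsComplete] [MeasureTheory.IsSeparable P]
    {d : ℕ} (τ : StochHom.E d → Ω → Ω)
    (hτ : StochHom.IsDynamicalSystem P τ) (herg : StochHom.IsErgodicSystem P τ)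
    (p : ℝ) (hp : 1 < p)
    (Q : Set (StochHom.E d)) (hQo : IsOpen Q) (hQb : Bornology.IsBounded Q)
    (V : Ω → StochHom.E d → StochHom.E d → ℝ)
    (hV1 : StochHom.IntegrandMeasurable Q V)
    (hV2 : StochHom.IntegrandConvex P Q V)
    (hV3 : StochHom.DegenerateGrowth P p Q V) :
    -- the homogenized integrands are finite for a.e. `x`, the functionals are never `-∞`
    (∀ᵐ x ∂(volume.restrict Q), ∀ F : StochHom.E d,
      (StochHom.Vhom P τ p V x F ≠ ⊥ ∧ StochHom.Vhom P τ p V x F ≠ ⊤) ∧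
      ∀ δ : ℝ, 0 < δ →
        StochHom.VhomReg P τ p V δ x F ≠ ⊥ ∧ StochHom.VhomReg P τ p V δ x F ≠ ⊤) ∧
    (∀ u : Lp ℝ 1 (volume.restrict Q), StochHom.Ehom P τ p Q V u ≠ ⊥ ∧
      ∀ δ : ℝ, 0 < δ → StochHom.EhomReg P τ p Q V δ u ≠ ⊥) ∧
    -- pointwise convergence
    (∀ x ∈ Q, ∀ F : StochHom.E d,
      Tendsto (fun δ : ℝ => StochHom.VhomReg P τ p V δ x F) (𝓝[>] 0)
        (𝓝 (StochHom.Vhom P τ p V x F))) ∧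
    -- Mosco convergence in `L^1(Q)`
    StochHom.MoscoTendsto (StochHom.EhomReg P τ p Q V) (StochHom.Ehom P τ p Q V) := by
  have hp1 : Fact (1 ≤ ENNReal.ofReal p) :=
    ⟨by rw [← ENNReal.ofReal_one]; exact ENNReal.ofReal_le_ofReal hp.le⟩
  have hpt : Fact (ENNReal.ofReal p ≠ ⊤) := ⟨ENNReal.ofReal_ne_top⟩
  have hfin : IsFiniteMeasure (volume.restrict Q) :=
    ⟨by rw [Measure.restrict_apply_univ]; exact hQb.measure_lt_top⟩
  obtain ⟨C, lam, hV⟩ := StochHom.exists_isDegenerateField hQo.measurableSet hV1 hV2 hV3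
  have hne : ∀ᵐ x ∂(volume.restrict Q), ∀ F : StochHom.E d, ∀ δ : ℝ, 0 ≤ δ →
      StochHom.VhomReg P τ p V δ x F ≠ ⊥ ∧ StochHom.VhomReg P τ p V δ x F ≠ ⊤ := by
    filter_upwards [hV.section_ae] with x hx F δ hδ
    have h : ((StochHom.homReal P τ p (fun ω => V ω x) δ F : ℝ) : EReal) =
        StochHom.VhomReg P τ p V δ x F := hx.coe_homReal hV.weight hp hτ hδ F
    rw [← h]
    exact ⟨EReal.coe_ne_bot _, EReal.coe_ne_top _⟩
  refine ⟨?_, fun u => ⟨?_, fun δ hδ => hV.ehomReg_ne_bot hp hτ hQo hδ.le u⟩,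
    fun x _ F => StochHom.tendsto_vhomReg hp x F, fun u u₀ hu => hV.le_liminf hp hτ hQo hQb hu,
    fun u₀ => ⟨fun _ => u₀, tendsto_const_nhds, hV.tendsto_ehomReg hp hτ hQo u₀⟩⟩
  · filter_upwards [hne] with x hx F
    refine ⟨?_, fun δ hδ => hx F δ hδ.le⟩
    rw [← StochHom.vhomReg_zero]
    exact hx F 0 le_rfl
  · rw [← StochHom.ehomReg_zero]
    exact hV.ehomReg_ne_bot hp hτ hQo le_rfl u
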